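/- Let $\mathbb K$ be an algebraically closed field of characteristic $0$ with a nontrivial valuation $\mathrm{val}:\mathbb K\to\mathbb R\cup\{\infty\}$ whose residue field also has characteristic $0$. Let $d\ge 1$ and let $A\subset\mathbb Z^d$ be a finite set, with $n$ elements, whose real affine span is $\mathbb R^d$. For an integral affine function $L(w)=j_1w_1+\dots+j_dw_d+\beta$ ($j_k,\beta\in\mathbb Z$) and the generic polynomial $F=\sum_{i\in A}y_ix^i$ in the variables $y_i$ ($i\in A$) and $x_1,\dots,x_d$, put $$\frac{\partial F}{\partial L}=\sum_{k=1}^d j_k\,x_k\frac{\partial F}{\partial x_k}+\beta F .$$ Let $\mathcal L'$ be the set of those $L$ for which the real affine span of $\{L=0\}\cap A$ has dimension $d-1$ (the empty set having dimension $-1$), and let $\mathcal L$ be the set of $L\in\mathcal L'$ with $\gcd(j_1,\dots,j_d)=1$. The tropicalization $\mathrm{Trop}(G)$ of a Laurent polynomial $G$ is the min-plus polynomial obtained by replacing coefficients by their valuations; the tropical hypersurface $\mathcal T(f)$ of a nonzero tropical polynomial $f$ is the set of points where the minimum of the terms of $f$ is attained at least twice. For an ideal $I$ of a Laurent polynomial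 ring in $N$ variables, $\mathrm{Trop}(I)=\{w\in\mathbb R^N: w\in\mathcal T(\mathrm{Trop}(G))\text{ for all nonzero }G\in I\}$; for a subvariety $V$ of a torus, $\mathrm{Trop}(V)=\mathrm{Trop}(I(V))$, where $I(V)$ is the ideal of all Laurent polynomials vanishing on $V$. A tropical basis of $I$ is a finite set of generators $G_1,\dots,G_r$ of $I$ with $\mathrm{Trop}(I)=\bigcap_k\mathcal T(\mathrm{Trop}(G_k))$; we also say that the tropical polynomials $\mathrm{Trop}(G_k)$ form a tropical basis of $\mathrm{Trop}(I)$. Identify $(\mathbb K^*)^n$ with the set of Laurent polynomials with support $A$, and let $$H=\{(F,u)\in(\mathbb K^*)^n\times(\mathbb K^*)^d : F \text{ is singular at } u\},\qquad H_1=\{F\in(\mathbb K^*)^n : F\text{ is singular at }(1,\dots,1)\},$$ where $F$ is singular at $u$ if $F$ and all $\partial F/\partial x_k$ vanish at $u$. Then: 1. The set $P'=\{\mathrm{Trop}(\partial F/\partial L): L\in\mathcal L'\}$ is finite and is a tropical basis of $\mathrm{Trop}(H)$: the polynomials $\partial F/\partial L$, $L\in\mathcal L'$, generate $I(H)$, and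 $\mathrm{Trop}(H)=\bigcap_{f\in P'}\mathcal T(f)$. Moreover $P'$ is already the set of all $\mathrm{Trop}(\partial F/\partial L)$ with $L\in\mathcal L$, and the set $\{\partial F/\partial L: L\in\mathcal L\}$ is finite and is a tropical basis of $I(H)$. 2. The finite set of tropical linear forms $P_1=\{\bigoplus_{i\in A\setminus\{L=0\}}0\odot v_i: L\in\mathcal L\}$ is a tropical basis of $\mathrm{Trop}(H_1)$: it is the set of tropicalizations of the linear forms $\sum_{i\in A}L(i)\,y_i$, $L\in\mathcal L$, and these form a tropical basis of $I(H_1)$; in particular $\mathrm{Trop}(H_1)=\bigcap_{f\in P_1}\mathcal T(f)$. -/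

import Mathlib

open scoped BigOperators

noncomputable section

namespace TropEuler

/-! ### Laurent polynomials over a field, and subsets of the torus -/

/-- Laurent polynomials over `K` in the variables indexed by `σ`; an exponent is a vector
`e : σ → ℤ`. -/
abbrev Laurent (K : Type*) [Field K] (σ : Type*) : Type _ := AddMonoidAlgebra K (σ → ℤ)

/-- The character `e ↦ ∏ k, u k ^ e k` of the lattice of exponents given by a point `u` of the
torus. -/
def expChar {K σ : Type*} [Field K] [Fintype σ] (u : σ → Kˣ) :
    Multiplicative (σ → ℤ) →* K where
  toFun e := ∏ k, ((u k ^ (e.toAdd k) : Kˣ) : K)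
  map_one' := by simp
  map_mul' a b := by simp [zpow_add, Finset.prod_mul_distrib]

/-- Evaluation of Laurent polynomials at a point of the torus. -/
def evalAt {K σ : Type*} [Field K] [Fintype σ] (u : σ → Kˣ) : Laurent K σ →ₐ[K] K :=
  AddMonoidAlgebra.lift K K (σ → ℤ) (expChar u)

/-- The formal partial derivative `∂/∂x_k`. -/
def partialDeriv {K σ : Type*} [Field K] [DecidableEq σ] (k : σ) (F : Laurent K σ) :
    Laurent K σ :=
  F.coeff.sum fun e a => AddMonoidAlgebra.single (e - Pi.single k 1) ((e k : K) * a)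

/-- The variable `x_k`. -/
def varX (K : Type*) {σ : Type*} [Field K] [DecidableEq σ] (k : σ) : Laurent K σ :=
  AddMonoidAlgebra.single (Pi.single k 1) 1

/-- `u` is a singular point of the hypersurface `F = 0` in the torus. -/
def IsSingularAt {K σ : Type*} [Field K] [Fintype σ] [DecidableEq σ] (F : Laurent K σ)
    (u : σ → Kˣ) : Prop :=
  evalAt u F = 0 ∧ ∀ k, evalAt u (partialDeriv k F) = 0

/-- The ideal of all Laurent polynomials vanishing on a subset `V` of the torus. -/
def vanishingIdeal {K σ : Type*} [Field K] [Fintype σ] (V : Set (σ → Kˣ)) :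
    Ideal (Laurent K σ) :=
  ⨅ u ∈ V, RingHom.ker (evalAt u)

/-! ### Tropical Laurent polynomials -/

/-- Tropical Laurent polynomials: Laurent polynomials over the min-plus semiring
`ℝ ∪ {∞}`. The coefficient at an absent monomial is the zero of that semiring, that is `∞`. -/
abbrev TropLaurent (σ : Type*) : Type _ :=
  AddMonoidAlgebra (Tropical (WithTop ℝ)) (σ → ℤ)

/-- The value at `w` of the tropical monomial `p ⊙ w^e`, that is `p + ⟨e, w⟩`. -/
def tropTerm {σ : Type*} [Fintype σ] (f : TropLaurent σ) (w : σ → ℝ) (e : σ → ℤ) :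
    Tropical (WithTop ℝ) :=
  f.coeff e * Tropical.trop (((∑ k, (e k : ℝ) * w k : ℝ)) : WithTop ℝ)

/-- The value `f(w)`: the tropical sum (that is, the minimum) of the terms of `f` at `w`. -/
def tropEval {σ : Type*} [Fintype σ] (f : TropLaurent σ) (w : σ → ℝ) :
    Tropical (WithTop ℝ) :=
  ∑ e ∈ f.coeff.support, tropTerm f w e

/-- The tropical hypersurface of a nonzero `f`: the points at which the minimum of the terms of
`f` is attained at least twice. -/
def tropHypersurface {σ : Type*} [Fintype σ] (f : TropLaurent σ) : Set (σ → ℝ) :=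
  {w | ∃ e₁ ∈ f.coeff.support, ∃ e₂ ∈ f.coeff.support, e₁ ≠ e₂ ∧
    tropEval f w = tropTerm f w e₁ ∧ tropEval f w = tropTerm f w e₂}

/-- The tropicalization of a Laurent polynomial: every coefficient is replaced by its
valuation. -/
def tropPoly {K σ : Type*} [Field K] (v : AddValuation K (WithTop ℝ)) (F : Laurent K σ) :
    TropLaurent σ :=
  AddMonoidAlgebra.ofCoeff
    (F.coeff.mapRange (fun a => Tropical.trop (v a)) (by rw [v.map_zero]; rfl))

/-- The tropicalization of an ideal: the weights lying on the tropical hypersurface of every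
nonzero member. -/
def tropIdeal {K σ : Type*} [Field K] [Fintype σ] (v : AddValuation K (WithTop ℝ))
    (I : Ideal (Laurent K σ)) : Set (σ → ℝ) :=
  {w | ∀ F ∈ I, F ≠ 0 → w ∈ tropHypersurface (tropPoly v F)}

/-- A tropical basis of an ideal `I`: a finite set of generators of `I` such that the
tropicalization of `I` is the intersection of their tropical hypersurfaces. -/
def IsTropicalBasis {K σ : Type*} [Field K] [Fintype σ] (v : AddValuation K (WithTop ℝ))
    (B : Set (Laurent K σ)) (I : Ideal (Laurent K σ)) : Prop :=
  B.Finite ∧ Ideal.span B = I ∧ tropIdeal v I = ⋂ F ∈ B, tropHypersurface (tropPoly v F)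

/-! ### Integral affine functions -/

/-- An integral affine function `L(w) = j_1 w_1 + ⋯ + j_d w_d + β`. -/
structure IntAffine (d : ℕ) where
  lin : Fin d → ℤ
  const : ℤ

/-- The value of `L` at a lattice point. -/
def IntAffine.eval {d : ℕ} (L : IntAffine d) (i : Fin d → ℤ) : ℤ :=
  ∑ k, L.lin k * i k + L.const

/-- The dimension of the real affine span of a set of lattice points; `-1` for the empty set. -/
def affineDim {d : ℕ} (S : Set (Fin d → ℤ)) : ℤ :=
  open Classical in
  if S.Nonempty then
    (Module.finrank ℝ
      (vectorSpan ℝ ((fun (i : Fin d → ℤ) (k : Fin d) => (i k : ℝ)) '' S)) : ℤ)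
  else -1

/-- The affine functions `L` for which `{L = 0} ∩ A` has an affine span of dimension `d - 1`. -/
def facetFunctions {d : ℕ} (A : Finset (Fin d → ℤ)) : Set (IntAffine d) :=
  {L | affineDim {i | i ∈ A ∧ L.eval i = 0} = (d : ℤ) - 1}

/-- The set `𝓛`: the functions as above with `gcd (j_1, …, j_d) = 1`. -/
def primitiveFacetFunctions {d : ℕ} (A : Finset (Fin d → ℤ)) : Set (IntAffine d) :=
  {L | L ∈ facetFunctions A ∧ Finset.univ.gcd L.lin = 1}

/-! ### Polynomials with support `A`, the incidence variety, Euler derivatives -/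

/-- The Laurent polynomial `∑ i ∈ A, a_i x^i` with coefficients `a` in the torus. -/
def polyOf {K : Type*} [Field K] {d : ℕ} (A : Finset (Fin d → ℤ)) (a : A → Kˣ) :
    Laurent K (Fin d) :=
  ∑ i : A, AddMonoidAlgebra.single (i : Fin d → ℤ) (a i : K)

/-- The incidence variety `H` of pairs `(F, u)` with `F` singular at `u`. A pair is a point of the
torus with coordinates `y_i`, `i ∈ A` (coefficients of `F`) and `x_1, …, x_d` (coordinates of
`u`). -/
def incidence (K : Type*) [Field K] {d : ℕ} (A : Finset (Fin d → ℤ)) :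
    Set (A ⊕ Fin d → Kˣ) :=
  {z | IsSingularAt (polyOf A fun i => z (Sum.inl i)) fun k => z (Sum.inr k)}

/-- The set `H_1` of polynomials with support `A` that are singular at `(1, …, 1)`. -/
def singularAtOne (K : Type*) [Field K] {d : ℕ} (A : Finset (Fin d → ℤ)) :
    Set (A → Kˣ) :=
  {a | IsSingularAt (polyOf A a) fun _ => 1}

/-- The generic polynomial `F = ∑ i ∈ A, y_i x^i` with support `A`, in the variables `y_i`
(`i ∈ A`) and `x_1, …, x_d`. -/
def genericPoly (K : Type*) [Field K] {d : ℕ} (A : Finset (Fin d → ℤ)) :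
    Laurent K (A ⊕ Fin d) :=
  ∑ i : A, AddMonoidAlgebra.single
    (Sum.elim (Pi.single i (1 : ℤ)) (i : Fin d → ℤ) : A ⊕ Fin d → ℤ) (1 : K)

/-- The Euler derivative `∂F/∂L = ∑ k, j_k x_k ∂F/∂x_k + β F` of the generic polynomial. -/
def genericEuler (K : Type*) [Field K] {d : ℕ} (A : Finset (Fin d → ℤ)) (L : IntAffine d) :
    Laurent K (A ⊕ Fin d) :=
  ∑ k : Fin d, (L.lin k : K) •
      (varX K (Sum.inr k) * partialDeriv (Sum.inr k) (genericPoly K A)) +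
    (L.const : K) • genericPoly K A

/-- The value at `x = (1, …, 1)` of the Euler derivative of the generic polynomial: the linear
form `∑ i ∈ A, L(i) y_i`. -/
def eulerForm (K : Type*) [Field K] {d : ℕ} (A : Finset (Fin d → ℤ)) (L : IntAffine d) :
    Laurent K A :=
  ∑ i : A, (L.eval i : K) • varX K i

/-- The tropical linear form `⊕ v_i` over the points `i ∈ A` with `L(i) ≠ 0`. -/
def tropForm {d : ℕ} (A : Finset (Fin d → ℤ)) (L : IntAffine d) : TropLaurent A :=
  ∑ i ∈ Finset.univ.filter (fun i : A => L.eval i ≠ 0),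
    AddMonoidAlgebra.single (Pi.single i (1 : ℤ) : A → ℤ)
      (Tropical.trop ((0 : ℝ) : WithTop ℝ))

end TropEuler

end

/-!
The incidence variety and the variety of polynomials singular at `(1, …, 1)` are treated together.
A polynomial with support `A` is singular at `u` if and only if the values `z_i` of its terms at
`u` satisfy `∑ i, L(i) z_i = 0` for all affine functions `L` (`isSingularAt_iff`). In both cases
the `z_i` are monomials whose exponents belong to a basis of the lattice of exponents, namely
`y_i x^i` and `y_i` respectively; so everything is stated for linear forms in such monomials.

*Facet functions.* Among all integral affine functions that separate a point `i` of `A` from a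
subset `S` of `A`, one with as many zeros in `A` as possible is a facet function
(`exists_mem_facetFunctions_of_int`), and a facet function is a multiple of a primitive one
(`exists_primitive`). Functions over a field of characteristic zero descend to integral ones
(`exists_intAffine`). Hence the primitive facet functions, which are finite in number, are the
elementary vectors of the space of affine functions on `A`, and every linear relation that they
impose holds for all affine functions (`sum_affEval_mul_eq_zero`).

*Generators.* A Laurent polynomial vanishing on the common zeros in the torus of some linear forms
belongs to the ideal they generate (`span_monoForm_eq_vanishingIdeal`). Modulo this ideal the
coordinates are congruent to their images under a linear projection onto the common zeros in affine
space; after multiplication with the product of all coordinates the substitution of this projection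
gives a polynomial that vanishes everywhere, so it is zero (`vanishingIdeal_le`).

*Tropicalization.* Let `w` lie on the tropical hypersurfaces of all the forms, and let `ω_i` be the
weights of the monomials. By linear duality there is, for each `i`, a rational common zero `y⁽ⁱ⁾`
of the forms with nonzero `i`-th coordinate and support in `{j | ω_j ≤ ω_i}`
(`exists_rational_zero`). Choose `t_i` in the field with pairwise distinct valuations close to
`ω_i` (`exists_units_unitVal_near`). In residue characteristic zero nonzero rational numbers have
valuation zero, so in `∑ i, t_i y⁽ⁱ⁾` nothing cancels, and this common zero has valuations close
to `ω`. If a member `F` of the ideal had a unique minimal term at `w`, it would have one at all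
nearby weights, and would not vanish at this point (`tropIdeal_vanishingIdeal_eq`).
-/

noncomputable section

namespace TropEuler

/-! ### Affine functions and facet functions -/

/-- Evaluation at the lattice point `i` of the affine functions `x ↦ ∑ j, p.1 j * x j + p.2` with
coefficients in a field `k`, as a linear form on the space of such functions. -/
def affEval (k : Type*) [Field k] {d : ℕ} (i : Fin d → ℤ) : ((Fin d → k) × k) →ₗ[k] k :=
  (∑ j, (i j : k) • (LinearMap.proj j ∘ₗ LinearMap.fst k (Fin d → k) k)) +
    LinearMap.snd k (Fin d → k) k

theorem affEval_apply {k : Type*} [Field k] {d : ℕ} (i : Fin d → ℤ) (p : (Fin d → k) × k) :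
    affEval k i p = ∑ j, p.1 j * (i j : k) + p.2 := by
  simp [affEval, LinearMap.sum_apply, mul_comm]

/-- An integral affine function, with its coefficients regarded as elements of `k`. -/
def IntAffine.toField (k : Type*) [Field k] {d : ℕ} (L : IntAffine d) : (Fin d → k) × k :=
  (fun j => (L.lin j : k), (L.const : k))

theorem affEval_toField (k : Type*) [Field k] {d : ℕ} (L : IntAffine d) (i : Fin d → ℤ) :
    affEval k i (L.toField k) = (L.eval i : k) := by
  simp [affEval_apply, IntAffine.toField, IntAffine.eval]

/-- Descent to `ℤ` of the existence of an affine function with given zeros and a given nonzero: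
apply a `ℚ`-linear form `k → ℚ` to the coefficients and clear denominators. -/
theorem exists_intAffine {k : Type*} [Field k] [CharZero k] {d : ℕ} {S : Set (Fin d → ℤ)}
    {i : Fin d → ℤ} (p : (Fin d → k) × k) (hS : ∀ j ∈ S, affEval k j p = 0)
    (hi : affEval k i p ≠ 0) :
    ∃ L : IntAffine d, (∀ j ∈ S, L.eval j = 0) ∧ L.eval i ≠ 0 := by
  obtain ⟨φ, hφ⟩ : ∃ φ : Module.Dual ℚ k, φ (affEval k i p) ≠ 0 := by
    by_contra! h
    exact hi ((Module.forall_dual_apply_eq_zero_iff ℚ _).1 h)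
  obtain ⟨N, hN⟩ := IsLocalization.exist_integer_multiples_of_finite (nonZeroDivisors ℤ)
    (fun o : Option (Fin d) => o.elim (φ p.2) fun j => φ (p.1 j))
  choose c hc using hN
  have hc' : ∀ o, (c o : ℚ) = (N : ℤ) * o.elim (φ p.2) fun j => φ (p.1 j) := by
    intro o
    have := hc o
    simpa [Algebra.smul_def] using this
  have key : ∀ j : Fin d → ℤ, ((∑ l, c (some l) * j l + c none : ℤ) : ℚ) =
      (N : ℤ) * φ (affEval k j p) := by
    intro j
    have h1 : ∀ l, φ (p.1 l * (j l : k)) = φ (p.1 l) * (j l : ℚ) := by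
      intro l
      rw [mul_comm, ← zsmul_eq_mul, map_zsmul, zsmul_eq_mul, mul_comm]
    rw [affEval_apply, map_add, map_sum]
    push_cast
    simp only [hc', h1, Option.elim, mul_add, Finset.mul_sum]
    congr 1
    exact Finset.sum_congr rfl fun l _ => by ring
  refine ⟨⟨fun l => c (some l), c none⟩, fun j hj => ?_, fun h0 => ?_⟩
  · have := key j
    rw [hS j hj, map_zero, mul_zero] at this
    exact_mod_cast this
  · have := key i
    rw [show (∑ l, c (some l) * i l + c none : ℤ) = 0 from h0, Int.cast_zero] at this
    have hN0 : ((N : ℤ) : ℚ) ≠ 0 := by exact_mod_cast nonZeroDivisors.coe_ne_zero N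
    exact (mul_ne_zero hN0 hφ) this.symm

/-- A lattice point as a point of `ℝ^d`. -/
def toReal {d : ℕ} (i : Fin d → ℤ) : Fin d → ℝ := fun k => (i k : ℝ)

theorem affineDim_of_mem {d : ℕ} {S : Set (Fin d → ℤ)} {z : Fin d → ℤ} (hz : z ∈ S) :
    affineDim S = (Module.finrank ℝ (vectorSpan ℝ (toReal '' S)) : ℤ) := by
  have : S.Nonempty := ⟨z, hz⟩
  rw [affineDim, if_pos this]
  rfl

/-- A real linear form killing the differences of the points of `S` kills the direction of the
affine span of `S`. -/
theorem vectorSpan_le_ker {d : ℕ} {S : Set (Fin d → ℤ)} {z : Fin d → ℤ}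
    (f : (Fin d → ℝ) →ₗ[ℝ] ℝ) (h : ∀ j ∈ S, f (toReal j) = f (toReal z)) :
    vectorSpan ℝ (toReal '' S) ≤ LinearMap.ker f := by
  rw [vectorSpan_def, Submodule.span_le]
  rintro _ ⟨_, ⟨x, hx, rfl⟩, _, ⟨y, hy, rfl⟩, rfl⟩
  simp [h x hx, h y hy]

/-- The linear part of an integral affine function as a linear form on `ℝ^d`. -/
def IntAffine.realLin {d : ℕ} (L : IntAffine d) : (Fin d → ℝ) →ₗ[ℝ] ℝ :=
  ∑ k, (L.lin k : ℝ) • LinearMap.proj k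

theorem IntAffine.realLin_apply {d : ℕ} (L : IntAffine d) (x : Fin d → ℝ) :
    L.realLin x = ∑ k, (L.lin k : ℝ) * x k := by
  simp [IntAffine.realLin, LinearMap.sum_apply]

theorem IntAffine.realLin_toReal {d : ℕ} (L : IntAffine d) (i : Fin d → ℤ) :
    L.realLin (toReal i) = (L.eval i : ℝ) - L.const := by
  simp [IntAffine.realLin_apply, IntAffine.eval, toReal]

section

variable {d : ℕ} {A : Finset (Fin d → ℤ)}

theorem nonempty_of_affineDim (hA : affineDim (A : Set (Fin d → ℤ)) = d) : A.Nonempty := by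
  by_contra h
  rw [Finset.not_nonempty_iff_eq_empty] at h
  subst h
  simp [affineDim] at hA

/-- A real linear form that is constant on a set of full dimension is zero. -/
theorem linearForm_eq_zero (hA : affineDim (A : Set (Fin d → ℤ)) = d) {z : Fin d → ℤ}
    (f : (Fin d → ℝ) →ₗ[ℝ] ℝ) (h : ∀ j ∈ A, f (toReal j) = f (toReal z)) : f = 0 := by
  obtain ⟨a, ha⟩ := nonempty_of_affineDim hA
  rw [affineDim_of_mem (Finset.mem_coe.2 ha)] at hA
  have htop : vectorSpan ℝ (toReal '' (A : Set (Fin d → ℤ))) = ⊤ :=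
    Submodule.eq_top_of_finrank_eq (by
      rw [Module.finrank_fin_fun]
      exact_mod_cast hA)
  rw [← LinearMap.ker_eq_top, eq_top_iff, ← htop]
  exact vectorSpan_le_ker f h

theorem exists_eval_ne_zero_of_mem_facetFunctions
    (hA : affineDim (A : Set (Fin d → ℤ)) = d) {L : IntAffine d} (hL : L ∈ facetFunctions A) :
    ∃ i ∈ A, L.eval i ≠ 0 := by
  by_contra! h
  have : {i | i ∈ A ∧ L.eval i = 0} = (A : Set (Fin d → ℤ)) := by
    ext i
    exact ⟨fun hi => hi.1, fun hi => ⟨hi, h i hi⟩⟩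
  have hL' : affineDim {i | i ∈ A ∧ L.eval i = 0} = (d : ℤ) - 1 := hL
  rw [this, hA] at hL'
  omega

theorem exists_zero_of_mem_facetFunctions (hd : 1 ≤ d) {L : IntAffine d}
    (hL : L ∈ facetFunctions A) : ∃ z ∈ A, L.eval z = 0 := by
  have hL' : affineDim {i | i ∈ A ∧ L.eval i = 0} = (d : ℤ) - 1 := hL
  by_contra! h
  have hne : ¬ ({i | i ∈ A ∧ L.eval i = 0} : Set (Fin d → ℤ)).Nonempty :=
    fun ⟨z, hz⟩ => h z hz.1 hz.2
  rw [affineDim, if_neg hne] at hL'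
  omega

/-- If the zeros of `L` in `A` together with one further point of `A` impose on affine functions
the same conditions as all of `A`, then the zeros of `L` in `A` span a hyperplane. -/
theorem mem_facetFunctions_of_forall (hd : 1 ≤ d)
    (hA : affineDim (A : Set (Fin d → ℤ)) = d) {L : IntAffine d} {i : Fin d → ℤ}
    (hi : L.eval i ≠ 0)
    (h : ∀ g : IntAffine d, (∀ j ∈ A, L.eval j = 0 → g.eval j = 0) → g.eval i = 0 →
      ∀ j ∈ A, g.eval j = 0) : L ∈ facetFunctions A := by
  -- By descent, the hypothesis on integral affine functions holds for the real ones as well.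
  have hreal : ∀ p : (Fin d → ℝ) × ℝ, (∀ j ∈ A, L.eval j = 0 → affEval ℝ j p = 0) →
      affEval ℝ i p = 0 → ∀ j ∈ A, affEval ℝ j p = 0 := by
    intro p h1 h2 j hj
    by_contra h3
    obtain ⟨g, hg, hgj⟩ := exists_intAffine (S := {x | (x ∈ A ∧ L.eval x = 0) ∨ x = i}) p
      (by rintro x (hx | rfl); exacts [h1 x hx.1 hx.2, h2]) h3
    exact hgj (h g (fun x hx hx0 => hg x (Or.inl ⟨hx, hx0⟩)) (hg i (Or.inr rfl)) j hj)
  have hlin : ∀ (f : (Fin d → ℝ) →ₗ[ℝ] ℝ), (∀ j ∈ A, L.eval j = 0 → f (toReal j) = f (toReal i)) →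
      f = 0 := by
    intro f hf
    have hev : ∀ j : Fin d → ℤ, affEval ℝ j (fun l => f (Pi.single l 1), - f (toReal i)) =
        f (toReal j) - f (toReal i) := by
      intro j
      rw [affEval_apply, ← sub_eq_add_neg]
      congr 1
      rw [LinearMap.pi_apply_eq_sum_univ f (toReal j)]
      exact Finset.sum_congr rfl fun l _ => by
        have hs : (Pi.single l 1 : Fin d → ℝ) = fun m => if l = m then 1 else 0 := by
          ext m
          simp [Pi.single_apply, eq_comm]
        dsimp only
        rw [smul_eq_mul, mul_comm, hs]
        rfl
    refine linearForm_eq_zero hA (z := i) f fun j hj => ?_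
    have := hreal (fun l => f (Pi.single l 1), - f (toReal i))
      (fun j hj h0 => by rw [hev, hf j hj h0, sub_self]) (by rw [hev, sub_self]) j hj
    rw [hev] at this
    linarith
  obtain ⟨z, hzA, hz⟩ : ∃ z ∈ A, L.eval z = 0 := by
    by_contra! hno
    have := hlin (LinearMap.proj ⟨0, hd⟩) fun j hj h0 => absurd h0 (hno j hj)
    have := congrArg (fun f => f (fun _ => (1 : ℝ))) this
    simp at this
  have hzS : z ∈ {i | i ∈ A ∧ L.eval i = 0} := ⟨hzA, hz⟩
  change affineDim {i | i ∈ A ∧ L.eval i = 0} = (d : ℤ) - 1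
  rw [affineDim_of_mem hzS]
  set U := vectorSpan ℝ (toReal '' {i | i ∈ A ∧ L.eval i = 0}) with hU
  have hUker : U ≤ LinearMap.ker L.realLin := vectorSpan_le_ker (z := z) _ fun j hj => by
    rw [L.realLin_toReal, L.realLin_toReal, hj.2, hz]
  have hker : LinearMap.ker L.realLin < ⊤ := by
    rw [lt_top_iff_ne_top, Ne, LinearMap.ker_eq_top]
    intro h0
    have h1 := L.realLin_toReal i
    have h2 := L.realLin_toReal z
    rw [h0, LinearMap.zero_apply] at h1 h2
    rw [hz] at h2
    apply hi
    have : (L.eval i : ℝ) = 0 := by push_cast at h2; linarith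
    exact_mod_cast this
  have hlt := Submodule.finrank_lt (lt_of_le_of_lt hUker hker).ne
  rw [Module.finrank_fin_fun] at hlt
  -- The direction `U` of the span of the zeros falls short of `ℝ^d` by one vector.
  have hsup : U ⊔ Submodule.span ℝ {toReal i - toReal z} = ⊤ := by
    by_contra hne
    obtain ⟨f, hf0, hf⟩ := Submodule.exists_le_ker_of_lt_top _ (lt_top_iff_ne_top.2 hne)
    apply hf0
    have hiz : f (toReal i) = f (toReal z) := by
      have : toReal i - toReal z ∈ LinearMap.ker f :=
        hf (Submodule.mem_sup_right (Submodule.mem_span_singleton_self _))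
      rw [LinearMap.mem_ker, map_sub] at this
      linarith
    refine hlin f fun j hj h0 => ?_
    have : toReal j -ᵥ toReal z ∈ U := vsub_mem_vectorSpan ℝ ⟨j, ⟨hj, h0⟩, rfl⟩ ⟨z, hzS, rfl⟩
    have : toReal j - toReal z ∈ LinearMap.ker f := hf (Submodule.mem_sup_left this)
    rw [LinearMap.mem_ker, map_sub] at this
    linarith
  have hle := Submodule.finrank_add_le_finrank_add_finrank U
    (Submodule.span ℝ {toReal i - toReal z})
  rw [hsup, finrank_top, Module.finrank_fin_fun] at hle
  have := finrank_span_le_card (R := ℝ) ({toReal i - toReal z} : Set (Fin d → ℝ))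
  rw [Set.toFinset_singleton, Finset.card_singleton] at this
  omega

/-- The point `i` being separated from `S` by an integral affine function, it is separated from
`S` by one whose zeros span a hyperplane. -/
theorem exists_mem_facetFunctions_of_int (hd : 1 ≤ d)
    (hA : affineDim (A : Set (Fin d → ℤ)) = d) {S : Set (Fin d → ℤ)} (hS : S ⊆ A)
    {i : Fin d → ℤ} (L : IntAffine d) (hL : ∀ j ∈ S, L.eval j = 0) (hi : L.eval i ≠ 0) :
    ∃ L ∈ facetFunctions A, (∀ j ∈ S, L.eval j = 0) ∧ L.eval i ≠ 0 := by
  induction hn : (A.filter fun j => L.eval j ≠ 0).card using Nat.strong_induction_on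
    generalizing L with
  | _ n ih =>
    by_cases h : ∀ g : IntAffine d, (∀ j ∈ A, L.eval j = 0 → g.eval j = 0) → g.eval i = 0 →
        ∀ j ∈ A, g.eval j = 0
    · exact ⟨L, mem_facetFunctions_of_forall hd hA hi h, hL, hi⟩
    · push Not at h
      obtain ⟨g, hg, hgi, j, hj, hgj⟩ := h
      -- `g j • L - L j • g` vanishes at `j` besides all zeros of `L`.
      let M : IntAffine d := ⟨fun l => g.eval j * L.lin l - L.eval j * g.lin l,
        g.eval j * L.const - L.eval j * g.const⟩
      have hM : ∀ x, M.eval x = g.eval j * L.eval x - L.eval j * g.eval x := by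
        intro x
        simp only [M, IntAffine.eval, sub_mul, Finset.sum_sub_distrib, mul_add, Finset.mul_sum,
          mul_assoc]
        ring
      have hLj : L.eval j ≠ 0 := fun h0 => hgj (hg j hj h0)
      refine ih _ ?_ M (fun x hx => ?_) ?_ rfl
      · rw [← hn]
        apply Finset.card_lt_card
        rw [Finset.ssubset_iff_of_subset]
        · refine ⟨j, by simp [hj, hLj], ?_⟩
          simp [hM, mul_comm]
        · intro x hx
          rw [Finset.mem_filter] at hx ⊢
          refine ⟨hx.1, fun h0 => hx.2 ?_⟩
          rw [hM, h0, hg x hx.1 h0]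
          simp
      · rw [hM, hL x hx, hg x (hS hx) (hL x hx)]
        simp
      · rw [hM, hgi]
        simp [hgj, hi]

/-- A facet function is an integral multiple of a primitive one. -/
theorem exists_primitive (hd : 1 ≤ d) (hA : affineDim (A : Set (Fin d → ℤ)) = d)
    {L : IntAffine d} (hL : L ∈ facetFunctions A) :
    ∃ M ∈ primitiveFacetFunctions A, ∃ g : ℤ, g ≠ 0 ∧ ∀ i, L.eval i = g * M.eval i := by
  obtain ⟨i, -, hi⟩ := exists_eval_ne_zero_of_mem_facetFunctions hA hL
  obtain ⟨z, -, hz⟩ := exists_zero_of_mem_facetFunctions hd hL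
  obtain ⟨c, hc, hc1⟩ := Finset.extract_gcd L.lin (Finset.univ_nonempty_iff.2 ⟨⟨0, hd⟩⟩)
  set g : ℤ := Finset.univ.gcd L.lin with hg
  let M : IntAffine d := ⟨c, -∑ l, c l * z l⟩
  have hev : ∀ x, L.eval x = g * M.eval x := by
    intro x
    have h1 : L.const = -∑ l, L.lin l * z l := by
      rw [IntAffine.eval] at hz
      linarith
    simp only [IntAffine.eval, M, h1, mul_add, Finset.mul_sum, mul_neg]
    congr 1
    · exact Finset.sum_congr rfl fun l _ => by rw [hc l (Finset.mem_univ l), mul_assoc]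
    · congr 1
      exact Finset.sum_congr rfl fun l _ => by rw [hc l (Finset.mem_univ l), mul_assoc]
  have hg0 : g ≠ 0 := by
    intro h0
    rw [hev, h0, zero_mul] at hi
    exact hi rfl
  refine ⟨M, ⟨?_, hc1⟩, g, hg0, hev⟩
  have hset : {i | i ∈ A ∧ M.eval i = 0} = {i | i ∈ A ∧ L.eval i = 0} := by
    ext x
    simp [hev, hg0]
  change affineDim {i | i ∈ A ∧ M.eval i = 0} = (d : ℤ) - 1
  rw [hset]
  exact hL

/-- A point separated from a subset of `A` by an affine function over a field of characteristic
zero is separated from it by a primitive facet function. -/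
theorem exists_mem_primitiveFacetFunctions {k : Type*} [Field k] [CharZero k] (hd : 1 ≤ d)
    (hA : affineDim (A : Set (Fin d → ℤ)) = d) {S : Set (Fin d → ℤ)} (hS : S ⊆ A)
    {i : Fin d → ℤ} (p : (Fin d → k) × k) (hp : ∀ j ∈ S, affEval k j p = 0)
    (hi : affEval k i p ≠ 0) :
    ∃ L ∈ primitiveFacetFunctions A, (∀ j ∈ S, L.eval j = 0) ∧ L.eval i ≠ 0 := by
  obtain ⟨L₀, h1, h2⟩ := exists_intAffine p hp hi
  obtain ⟨L, hL, h3, h4⟩ := exists_mem_facetFunctions_of_int hd hA hS L₀ h1 h2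
  obtain ⟨M, hM, g, hg, hev⟩ := exists_primitive hd hA hL
  refine ⟨M, hM, fun j hj => ?_, fun h0 => h4 (by rw [hev, h0, mul_zero])⟩
  have := h3 j hj
  rw [hev] at this
  exact (mul_eq_zero.1 this).resolve_left hg

/-- An affine function vanishing at the zeros in `A` of a facet function `L` has a linear part
proportional to that of `L`, because both kill the direction of the same hyperplane. -/
theorem lin_mul_lin_comm (hd : 1 ≤ d) (hA : affineDim (A : Set (Fin d → ℤ)) = d)
    {L M : IntAffine d} (hL : L ∈ facetFunctions A)
    (h : ∀ j ∈ A, L.eval j = 0 → M.eval j = 0) (k l : Fin d) :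
    M.lin k * L.lin l = L.lin k * M.lin l := by
  obtain ⟨i, hiA, hi⟩ := exists_eval_ne_zero_of_mem_facetFunctions hA hL
  obtain ⟨z, hzA, hz⟩ := exists_zero_of_mem_facetFunctions hd hL
  have hzS : z ∈ {i | i ∈ A ∧ L.eval i = 0} := ⟨hzA, hz⟩
  have hdim : affineDim {i | i ∈ A ∧ L.eval i = 0} = (d : ℤ) - 1 := hL
  rw [affineDim_of_mem hzS] at hdim
  set U := vectorSpan ℝ (toReal '' {i | i ∈ A ∧ L.eval i = 0}) with hU
  have hUL : U ≤ LinearMap.ker L.realLin := vectorSpan_le_ker (z := z) _ fun j hj => by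
    rw [L.realLin_toReal, L.realLin_toReal, hj.2, hz]
  have hUM : U ≤ LinearMap.ker M.realLin := vectorSpan_le_ker (z := z) _ fun j hj => by
    rw [M.realLin_toReal, M.realLin_toReal, h j hj.1 hj.2, h z hzA hz]
  have hL0 : L.realLin (toReal i - toReal z) ≠ 0 := by
    rw [map_sub, L.realLin_toReal, L.realLin_toReal, hz]
    simpa using hi
  have hker : LinearMap.ker L.realLin < ⊤ := by
    rw [lt_top_iff_ne_top, Ne, LinearMap.ker_eq_top]
    intro h0
    rw [h0] at hL0
    exact hL0 rfl
  have hlt := Submodule.finrank_lt hker.ne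
  rw [Module.finrank_fin_fun] at hlt
  have heq : U = LinearMap.ker L.realLin := Submodule.eq_of_le_of_finrank_le hUL (by omega)
  rw [heq] at hUM
  have key : ∀ x y, M.realLin x * L.realLin y = L.realLin x * M.realLin y := by
    intro x y
    have : L.realLin y • x - L.realLin x • y ∈ LinearMap.ker M.realLin := hUM (by
      simp only [LinearMap.mem_ker, map_sub, map_smul, smul_eq_mul]
      ring)
    simp only [LinearMap.mem_ker, map_sub, map_smul, smul_eq_mul] at this
    linarith
  have hs : ∀ (N : IntAffine d) k, N.realLin (Pi.single k 1) = N.lin k := by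
    intro N k
    simp [IntAffine.realLin_apply, Pi.single_apply]
  have := key (Pi.single k 1) (Pi.single l 1)
  simp only [hs] at this
  exact_mod_cast this

theorem abs_lin_eq_of_primitive (hd : 1 ≤ d) (hA : affineDim (A : Set (Fin d → ℤ)) = d)
    {L M : IntAffine d} (hL : L ∈ primitiveFacetFunctions A)
    (hM : M ∈ primitiveFacetFunctions A)
    (h : ∀ j ∈ A, L.eval j = 0 → M.eval j = 0) (l : Fin d) : |M.lin l| = |L.lin l| := by
  have h1 : Finset.univ.gcd (fun k => M.lin k * L.lin l) =
      Finset.univ.gcd (fun k => L.lin k * M.lin l) :=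
    Finset.gcd_congr rfl fun k _ => lin_mul_lin_comm hd hA hL.1 h k l
  rw [Finset.gcd_mul_right, Finset.gcd_mul_right, hM.2, hL.2, one_mul, one_mul,
    ← Int.abs_eq_normalize, ← Int.abs_eq_normalize] at h1
  exact h1.symm

/-- There are finitely many primitive facet functions: one is determined by its zeros in `A` and
the signs of its coefficients. -/
theorem finite_primitiveFacetFunctions (hd : 1 ≤ d)
    (hA : affineDim (A : Set (Fin d → ℤ)) = d) : (primitiveFacetFunctions A).Finite := by
  classical
  refine Set.Finite.of_injOn (f := fun L : IntAffine d =>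
    (A.filter fun i => L.eval i = 0, fun l => decide (0 ≤ L.lin l)))
    (t := (↑A.powerset : Set (Finset (Fin d → ℤ))) ×ˢ Set.univ)
    (fun L _ => ⟨Finset.mem_coe.2 (Finset.mem_powerset.2 (Finset.filter_subset _ _)), trivial⟩) ?_
    (A.powerset.finite_toSet.prod Set.finite_univ)
  rintro ⟨l₁, c₁⟩ hL ⟨l₂, c₂⟩ hM heq
  obtain ⟨hz, hs⟩ := Prod.ext_iff.1 heq
  have hzero : ∀ j ∈ A, IntAffine.eval ⟨l₁, c₁⟩ j = 0 → IntAffine.eval ⟨l₂, c₂⟩ j = 0 := by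
    intro j hj h0
    have : j ∈ A.filter fun i => IntAffine.eval ⟨l₁, c₁⟩ i = 0 := Finset.mem_filter.2 ⟨hj, h0⟩
    exact (Finset.mem_filter.1 (hz.subset this)).2
  have hlin : l₁ = l₂ := by
    funext l
    have h1 := abs_lin_eq_of_primitive hd hA hL hM hzero l
    have h2 : (0 ≤ l₁ l) ↔ (0 ≤ l₂ l) := decide_eq_decide.1 (congrFun hs l)
    dsimp only at h1
    rcases abs_eq_abs.1 h1 with h | h <;> omega
  obtain ⟨z, hzA, hz0⟩ := exists_zero_of_mem_facetFunctions hd hL.1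
  have hz1 := hzero z hzA hz0
  subst hlin
  simp only [IntAffine.eval] at hz0 hz1
  have : c₁ = c₂ := by linarith
  rw [this]

/-- Linear relations imposed by the primitive facet functions are satisfied by all affine
functions. -/
theorem sum_affEval_mul_eq_zero {k : Type*} [Field k] [CharZero k] (hd : 1 ≤ d)
    (hA : affineDim (A : Set (Fin d → ℤ)) = d) {y : A → k}
    (hy : ∀ L ∈ primitiveFacetFunctions A, ∑ i : A, (L.eval i : k) * y i = 0)
    (p : (Fin d → k) × k) : ∑ i : A, affEval k (i : Fin d → ℤ) p * y i = 0 := by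
  classical
  induction hn : (A.filter fun j => affEval k j p ≠ 0).card using Nat.strong_induction_on
    generalizing p with
  | _ n ih =>
    by_cases h : ∀ i ∈ A, affEval k i p = 0
    · exact Finset.sum_eq_zero fun i _ => by rw [h i i.2, zero_mul]
    · push Not at h
      obtain ⟨i, hiA, hi⟩ := h
      obtain ⟨L, hL, hz, hLi⟩ := exists_mem_primitiveFacetFunctions hd hA
        (S := {j | j ∈ A ∧ affEval k j p = 0}) (fun j hj => hj.1) p (fun j hj => hj.2) hi
      have hLi' : (L.eval i : k) ≠ 0 := by exact_mod_cast hLi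
      set q := p - (affEval k i p / (L.eval i : k)) • L.toField k with hq
      have hqe : ∀ j, affEval k j q =
          affEval k j p - affEval k i p / (L.eval i : k) * (L.eval j : k) := by
        intro j
        rw [hq, map_sub, map_smul, affEval_toField, smul_eq_mul]
      have := ih _ ?_ q rfl
      · simp only [hqe, sub_mul, Finset.sum_sub_distrib, mul_assoc, ← Finset.mul_sum,
          hy L hL, mul_zero, sub_zero] at this
        exact this
      · rw [← hn]
        apply Finset.card_lt_card
        rw [Finset.ssubset_iff_of_subset]
        · refine ⟨i, by simp [hiA, hi], ?_⟩
          simp [hqe, hLi']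
        · intro x hx
          rw [Finset.mem_filter] at hx ⊢
          refine ⟨hx.1, fun h0 => hx.2 ?_⟩
          rw [hqe, h0, hz x ⟨hx.1, h0⟩]
          simp

end

/-! ### Monomial coordinates on the torus -/

theorem evalAt_single {K σ : Type*} [Field K] [Fintype σ] (u : σ → Kˣ) (e : σ → ℤ) (c : K) :
    evalAt u (AddMonoidAlgebra.single e c) = c * ((∏ k, u k ^ e k : Kˣ) : K) := by
  simp [evalAt, AddMonoidAlgebra.lift_single, expChar]

theorem mem_vanishingIdeal {K σ : Type*} [Field K] [Fintype σ] {V : Set (σ → Kˣ)}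
    {G : Laurent K σ} : G ∈ vanishingIdeal V ↔ ∀ u ∈ V, evalAt u G = 0 := by
  simp [vanishingIdeal, RingHom.mem_ker]

section

variable {K σ ι : Type*} [Field K] [Fintype ι]
  (b : Module.Basis σ ℤ (σ → ℤ))

/-- The point of the torus at which the monomials with exponents `b t` take the values `s t`. -/
def monoPoint [Fintype σ] [DecidableEq σ] (s : σ → Kˣ) : σ → Kˣ :=
  fun t => ∏ r, s r ^ b.repr (Pi.single t 1) r

theorem prod_monoPoint_zpow [Fintype σ] [DecidableEq σ] (s : σ → Kˣ) (e : σ → ℤ) :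
    ∏ k, monoPoint b s k ^ e k = ∏ r, s r ^ b.repr e r := by
  have h : ∀ r, b.repr e r = ∑ k, b.repr (Pi.single k 1) r * e k := by
    intro r
    conv_lhs => rw [pi_eq_sum_univ' e]
    rw [map_sum, Finsupp.finsetSum_apply]
    refine Finset.sum_congr rfl fun k _ => ?_
    rw [map_smul, Finsupp.smul_apply, smul_eq_mul, mul_comm]
  simp only [h, monoPoint, ← Finset.prod_zpow, ← zpow_mul]
  rw [Finset.prod_comm]
  refine Finset.prod_congr rfl fun r _ => ?_
  exact (Finset.sum_smul (R := ℤ) (M := Additive Kˣ)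
    (f := fun k => b.repr (Pi.single k 1) r * e k) (s := Finset.univ)
    (x := Additive.ofMul (s r))).symm

theorem evalAt_monoPoint_single [Fintype σ] [DecidableEq σ] (s : σ → Kˣ) (t : σ) (c : K) :
    evalAt (monoPoint b s) (AddMonoidAlgebra.single (b t) c) = c * s t := by
  rw [evalAt_single, prod_monoPoint_zpow, b.repr_self]
  congr 2
  rw [Finset.prod_eq_single t (fun r _ hr => by simp [hr.symm])
    (fun h => absurd (Finset.mem_univ t) h)]
  simp

/-- The homomorphism from polynomials to Laurent polynomials that sends the variable `X t` to the
monomial with exponent `b t`. -/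
def polyToLaurent (K : Type*) [Field K] : MvPolynomial σ K →ₐ[K] Laurent K σ :=
  MvPolynomial.aeval fun t => AddMonoidAlgebra.single (b t) 1

theorem polyToLaurent_X (t : σ) :
    polyToLaurent b K (MvPolynomial.X t) = AddMonoidAlgebra.single (b t) 1 :=
  MvPolynomial.aeval_X _ t

theorem polyToLaurent_monomial [Fintype σ] (m : σ →₀ ℕ) (c : K) :
    polyToLaurent b K (MvPolynomial.monomial m c) =
      AddMonoidAlgebra.single (∑ t, (m t : ℤ) • b t) c := by
  rw [polyToLaurent, MvPolynomial.aeval_monomial, Finsupp.prod_fintype _ _ (by simp)]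
  simp only [AddMonoidAlgebra.single_pow, one_pow, AddMonoidAlgebra.prod_single,
    Finset.prod_const_one, AddMonoidAlgebra.coe_algebraMap, Function.comp_apply,
    Algebra.algebraMap_self, RingHom.id_apply, AddMonoidAlgebra.single_mul_single, zero_add,
    mul_one, natCast_zsmul]

theorem isUnit_single (e : σ → ℤ) : IsUnit (AddMonoidAlgebra.single e (1 : K)) :=
  IsUnit.of_mul_eq_one (AddMonoidAlgebra.single (-e) 1) (by
    rw [AddMonoidAlgebra.single_mul_single, add_neg_cancel, mul_one]
    rfl)

/-- Up to a monomial factor, every Laurent polynomial is a polynomial in the monomials with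
exponents `b t`. -/
theorem exists_polyToLaurent_eq [Fintype σ] (G : Laurent K σ) :
    ∃ (m : σ →₀ ℕ) (p : MvPolynomial σ K),
    polyToLaurent b K p = polyToLaurent b K (MvPolynomial.monomial m 1) * G := by
  induction G using AddMonoidAlgebra.induction_linear with
  | zero => exact ⟨0, 0, by simp⟩
  | add F G hF hG =>
    obtain ⟨m, p, hp⟩ := hF
    obtain ⟨n, q, hq⟩ := hG
    refine ⟨m + n, MvPolynomial.monomial n 1 * p + MvPolynomial.monomial m 1 * q, ?_⟩
    have h1 : (MvPolynomial.monomial (m + n) (1 : K)) =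
        MvPolynomial.monomial m 1 * MvPolynomial.monomial n 1 := by
      rw [MvPolynomial.monomial_mul, one_mul]
    rw [h1, map_add, map_mul, map_mul, map_mul, hp, hq]
    ring
  | single e c =>
    refine ⟨Finsupp.equivFunOnFinite.symm fun t => (-b.repr e t).toNat,
      MvPolynomial.monomial (Finsupp.equivFunOnFinite.symm fun t => (b.repr e t).toNat) c, ?_⟩
    rw [polyToLaurent_monomial, polyToLaurent_monomial, AddMonoidAlgebra.single_mul_single,
      one_mul]
    congr 1
    have he : ∀ x : σ → ℤ, x = e → x = ∑ t, b.repr e t • b t := fun x hx => by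
      rw [b.sum_repr, hx]
    nth_rewrite 3 [he e rfl]
    rw [← Finset.sum_add_distrib]
    refine Finset.sum_congr rfl fun t _ => ?_
    rw [← add_smul]
    congr 1
    simp only [Finsupp.equivFunOnFinite_symm_apply_apply]
    omega

/-- A Nullstellensatz for subsets of the torus with a polynomial parametrization `ρ`: if every
value of `ρ` in the torus gives a point of `V` and `ρ` is congruent to the identity modulo `J`,
then the ideal of `V` is contained in `J`. -/
theorem vanishingIdeal_le [Fintype σ] [DecidableEq σ] [Infinite K] (J : Ideal (Laurent K σ))
    (V : Set (σ → Kˣ))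
    (ρ : σ → MvPolynomial σ K)
    (hρ : ∀ t, polyToLaurent b K (MvPolynomial.X t) - polyToLaurent b K (ρ t) ∈ J)
    (hV : ∀ (s : σ → Kˣ) (x : σ → K), (∀ t, MvPolynomial.eval x (ρ t) = s t) →
      monoPoint b s ∈ V) :
    vanishingIdeal V ≤ J := by
  intro G hG
  rw [mem_vanishingIdeal] at hG
  obtain ⟨m, p, hp⟩ := exists_polyToLaurent_eq b G
  set q : MvPolynomial σ K := p * ∏ t, MvPolynomial.X t with hq
  -- The factor `∏ t, X t` takes care of the values of `ρ` outside the torus.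
  have hzero : MvPolynomial.aeval ρ q = 0 := by
    refine MvPolynomial.funext fun x => ?_
    have hcomp : MvPolynomial.eval x (MvPolynomial.aeval ρ q) =
        MvPolynomial.eval (fun t => MvPolynomial.eval x (ρ t)) q := by
      have : ((MvPolynomial.aeval x).comp (MvPolynomial.aeval ρ) :
          MvPolynomial σ K →ₐ[K] K) =
          MvPolynomial.aeval fun t => MvPolynomial.eval x (ρ t) := by
        ext t
        simp [MvPolynomial.aeval_eq_eval]
      have := DFunLike.congr_fun this q
      simpa [MvPolynomial.aeval_eq_eval] using this
    rw [hcomp, map_zero, hq, map_mul, map_prod]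
    simp only [MvPolynomial.eval_X]
    by_cases h0 : ∃ t, MvPolynomial.eval x (ρ t) = 0
    · obtain ⟨t, ht⟩ := h0
      rw [Finset.prod_eq_zero (Finset.mem_univ t) ht, mul_zero]
    · push Not at h0
      let s : σ → Kˣ := fun t => Units.mk0 _ (h0 t)
      have hs : monoPoint b s ∈ V := hV s x fun t => rfl
      have hev : ∀ r : MvPolynomial σ K, evalAt (monoPoint b s) (polyToLaurent b K r) =
          MvPolynomial.eval (fun t => MvPolynomial.eval x (ρ t)) r := by
        intro r
        have : (evalAt (monoPoint b s)).comp (polyToLaurent b K) =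
            MvPolynomial.aeval fun t => MvPolynomial.eval x (ρ t) := by
          ext t
          simp [polyToLaurent_X, evalAt_monoPoint_single, s]
        have := DFunLike.congr_fun this r
        simpa [MvPolynomial.aeval_eq_eval] using this
      rw [← hev p, hp, map_mul, hG _ hs, mul_zero, zero_mul]
  have hmod : polyToLaurent b K q ∈ J := by
    have : (Ideal.Quotient.mkₐ K J).comp (polyToLaurent b K) =
        ((Ideal.Quotient.mkₐ K J).comp (polyToLaurent b K)).comp (MvPolynomial.aeval ρ) := by
      ext t
      simp only [AlgHom.comp_apply, Ideal.Quotient.mkₐ_eq_mk, MvPolynomial.aeval_X]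
      exact Ideal.Quotient.eq.2 (hρ t)
    have := DFunLike.congr_fun this q
    rw [AlgHom.comp_apply, AlgHom.comp_apply _ (MvPolynomial.aeval ρ), hzero, map_zero,
      Ideal.Quotient.mkₐ_eq_mk] at this
    exact Ideal.Quotient.eq_zero_iff_mem.1 this
  have hunit : IsUnit (∏ t, AddMonoidAlgebra.single (b t) (1 : K) : Laurent K σ) := by
    rw [AddMonoidAlgebra.prod_single, Finset.prod_const_one]
    exact isUnit_single _
  rw [hq, map_mul, map_prod, hp, polyToLaurent_monomial] at hmod
  simp only [polyToLaurent_X] at hmod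
  rwa [Ideal.mul_unit_mem_iff_mem _ hunit, Ideal.unit_mul_mem_iff_mem _ (isUnit_single _)] at hmod

/-! ### Ideals generated by linear forms in monomials -/

variable (a : ι → σ)

/-- The linear form with coefficients `c` in the monomials with exponents `b (a i)`. -/
def monoForm (c : ι → K) : Laurent K σ := ∑ i, AddMonoidAlgebra.single (b (a i)) (c i)

theorem evalAt_monoForm [Fintype σ] (u : σ → Kˣ) (c : ι → K) :
    evalAt u (monoForm b a c) = ∑ i, c i * ((∏ k, u k ^ b (a i) k : Kˣ) : K) := by
  simp [monoForm, evalAt_single]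

theorem evalAt_monoPoint_monoForm [Fintype σ] [DecidableEq σ] (s : σ → Kˣ) (c : ι → K) :
    evalAt (monoPoint b s) (monoForm b a c) = ∑ i, c i * s (a i) := by
  simp [monoForm, evalAt_monoPoint_single]

/-- Linear forms in the monomials `b (a i)` generate the ideal of their common zeros in the torus:
a linear projection onto their common zeros in `K^ι` is congruent to the identity modulo these
forms. -/
theorem span_monoForm_eq_vanishingIdeal [Fintype σ] [DecidableEq σ] [Infinite K] [DecidableEq ι]
    (ha : Function.Injective a) (Λ : Set (ι → K)) :
    Ideal.span (monoForm b a '' Λ) =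
      vanishingIdeal {u | ∀ c ∈ Λ, evalAt u (monoForm b a c) = 0} := by
  refine le_antisymm ?_ ?_
  · rw [Ideal.span_le]
    rintro _ ⟨c, hc, rfl⟩
    exact mem_vanishingIdeal.2 fun u hu => hu c hc
  set J := Ideal.span (monoForm b a '' Λ) with hJ
  let pair : (ι → K) → Module.Dual K (ι → K) := fun c => ∑ i, c i • LinearMap.proj i
  have hpair : ∀ c y, pair c y = ∑ i, c i * y i := fun c y => by
    simp [pair, LinearMap.sum_apply]
  let E : Submodule K (ι → K) := ⨅ c : Λ, LinearMap.ker (pair c)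
  obtain ⟨π, hπ⟩ := LinearMap.exists_leftInverse_of_injective E.subtype E.ker_subtype
  let M : (ι → K) →ₗ[K] (ι → K) := E.subtype ∘ₗ π
  have hMmem : ∀ y, M y ∈ E := fun y => (π y).2
  have hMid : ∀ y ∈ E, M y = y := fun y hy => by
    have := DFunLike.congr_fun hπ ⟨y, hy⟩
    exact congrArg Subtype.val this
  -- A linear form vanishing on `E` is a combination of those in `Λ`, so its monomial version
  -- belongs to `J`; this applies to the coordinates of `y - M y`.
  let form : Module.Dual K (ι → K) →ₗ[K] Laurent K σ :=
    { toFun := fun f => monoForm b a fun i => f (Pi.single i 1)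
      map_add' := fun f g => by
        simp [monoForm, AddMonoidAlgebra.single_add, Finset.sum_add_distrib]
      map_smul' := fun r f => by
        simp [monoForm, Finset.smul_sum, AddMonoidAlgebra.smul_single] }
  have hform : ∀ f : Module.Dual K (ι → K), E ≤ LinearMap.ker f → form f ∈ J := by
    intro f hf
    have hspan : f ∈ Submodule.span K (Set.range fun c : Λ => pair c) :=
      FiniteDimensional.mem_span_of_iInf_ker_le_ker hf
    have hle : Submodule.span K (Set.range fun c : Λ => pair c) ≤
        (J.restrictScalars K).comap form := by
      rw [Submodule.span_le]
      rintro _ ⟨c, rfl⟩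
      refine Ideal.subset_span ⟨c, c.2, ?_⟩
      change monoForm b a _ = monoForm b a _
      congr 1
      ext i
      simp [hpair, Pi.single_apply]
    exact hle hspan
  classical
  let ρ : σ → MvPolynomial σ K := fun t =>
    if h : ∃ i, a i = t then
      ∑ j, MvPolynomial.C (M (Pi.single j 1) h.choose) * MvPolynomial.X (a j)
    else MvPolynomial.X t
  have hρa : ∀ i, ρ (a i) =
      ∑ j, MvPolynomial.C (M (Pi.single j 1) i) * MvPolynomial.X (a j) := by
    intro i
    have h : ∃ j, a j = a i := ⟨i, rfl⟩
    simp only [ρ, dif_pos h, ha h.choose_spec]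
  refine vanishingIdeal_le b J _ ρ (fun t => ?_) fun s x hs => ?_
  · by_cases h : ∃ i, a i = t
    · obtain ⟨i, rfl⟩ := h
      have := hform (LinearMap.proj i ∘ₗ (LinearMap.id - M)) fun y hy => by
        simp [hMid y hy]
      convert this using 1
      change _ = monoForm b a fun j => (Pi.single j (1 : K) : ι → K) i - M (Pi.single j 1) i
      rw [hρa, map_sum]
      simp only [monoForm, AddMonoidAlgebra.single_sub, Finset.sum_sub_distrib]
      congr 1
      · rw [polyToLaurent_X, Finset.sum_eq_single i]
        · simp
        · intro j _ hj
          simp [hj.symm]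
        · exact fun h => absurd (Finset.mem_univ i) h
      · refine Finset.sum_congr rfl fun j _ => ?_
        rw [map_mul, polyToLaurent_X, ← MvPolynomial.algebraMap_eq, AlgHom.commutes,
          ← Algebra.smul_def, AddMonoidAlgebra.smul_single, smul_eq_mul, mul_one]
    · simp only [ρ, dif_neg h, sub_self, J.zero_mem]
  · intro c hc
    rw [evalAt_monoPoint_monoForm]
    have hsM : ∀ i, (s (a i) : K) = M (fun j => x (a j)) i := by
      intro i
      rw [← hs, hρa, map_sum]
      conv_rhs => rw [pi_eq_sum_univ' (fun j => x (a j))]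
      rw [map_sum, Finset.sum_apply]
      refine Finset.sum_congr rfl fun j _ => ?_
      rw [map_smul]
      simp only [map_mul, MvPolynomial.eval_C, MvPolynomial.eval_X, Pi.smul_apply, smul_eq_mul]
      rw [mul_comm]
    have := hMmem fun j => x (a j)
    rw [Submodule.mem_iInf] at this
    have := this ⟨c, hc⟩
    rw [LinearMap.mem_ker, hpair] at this
    simpa only [hsM] using this

end

/-! ### Valuations of integers, sums and units -/

section

variable {K : Type*} [Field K] (v : AddValuation K (WithTop ℝ))

theorem val_intCast_eq_zero [CharZero (IsLocalRing.ResidueField v.valuationSubring)] {n : ℤ}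
    (hn : n ≠ 0) : v (n : K) = 0 := by
  have hu : IsUnit (n : v.valuationSubring) := by
    rw [← IsLocalRing.residue_ne_zero_iff_isUnit, map_intCast]
    exact_mod_cast hn
  exact (Valuation.Integers.isUnit_iff_valuation_eq_one (Valuation.integer.integers v)).1 hu

theorem val_ratCast_eq_zero [CharZero K]
    [CharZero (IsLocalRing.ResidueField v.valuationSubring)] {q : ℚ} (hq : q ≠ 0) :
    v (q : K) = 0 := by
  have h1 : (q : K) * ((q.den : ℤ) : K) = (q.num : K) := by
    have := Rat.mul_den_eq_num q
    exact_mod_cast congrArg (Rat.cast : ℚ → K) this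
  have h2 := congrArg v h1
  rwa [v.map_mul, val_intCast_eq_zero v (by exact_mod_cast q.den_ne_zero),
    val_intCast_eq_zero v (by simpa using hq), add_zero] at h2

theorem val_sum_eq {ι : Type*} {s : Finset ι} {f : ι → K} {j : ι} (hj : j ∈ s) (hj0 : f j ≠ 0)
    (h : ∀ i ∈ s, i ≠ j → v (f j) < v (f i)) : v (∑ i ∈ s, f i) = v (f j) := by
  classical
  rw [← Finset.add_sum_erase s f hj]
  refine v.map_add_eq_of_lt_left (v.map_lt_sum (v.ne_top_iff.2 hj0) fun i hi => ?_)
  exact h i (Finset.mem_of_mem_erase hi) (Finset.ne_of_mem_erase hi)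

/-- The valuation of a unit as a real number, as a homomorphism. -/
def unitVal : Kˣ →* Multiplicative ℝ where
  toFun u := Multiplicative.ofAdd ((v u).untop (v.ne_top_iff.2 u.ne_zero))
  map_one' := by simp
  map_mul' x y := by
    rw [← ofAdd_add]
    congr 1
    rw [← WithTop.coe_inj, WithTop.coe_add]
    simp

theorem coe_unitVal (u : Kˣ) : (((unitVal v u).toAdd : ℝ) : WithTop ℝ) = v u := by
  simp [unitVal]

/-- Real vectors are approximated by vectors of valuations with pairwise distinct entries: if `x`
has a small positive valuation `η` and `N` exceeds the number of entries, powers of `x` whose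
exponents are distinct modulo `N` reach every real number up to `N * η`. -/
theorem exists_units_unitVal_near [IsAlgClosed K] (hv : ∃ t : K, t ≠ 0 ∧ v t ≠ 0) {σ : Type*}
    [Fintype σ] (ω : σ → ℝ) {ε : ℝ} (hε : 0 < ε) :
    ∃ t : σ → Kˣ, (Function.Injective fun r => (unitVal v (t r)).toAdd) ∧
      ∀ r, |(unitVal v (t r)).toAdd - ω r| < ε := by
  obtain ⟨u, hu⟩ : ∃ u : Kˣ, 0 < (unitVal v u).toAdd := by
    obtain ⟨t, ht, hvt⟩ := hv
    have hne : (unitVal v (Units.mk0 t ht)).toAdd ≠ 0 := by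
      intro h0
      have := coe_unitVal v (Units.mk0 t ht)
      rw [h0] at this
      exact hvt this.symm
    rcases lt_or_gt_of_ne hne with h | h
    · refine ⟨(Units.mk0 t ht)⁻¹, ?_⟩
      rw [map_inv, toAdd_inv]
      linarith
    · exact ⟨_, h⟩
  set c := (unitVal v u).toAdd with hc
  set N : ℕ := Fintype.card σ + 1 with hN
  have hN0 : (0 : ℝ) < N := by positivity
  obtain ⟨n, hn⟩ := exists_nat_gt (N * c / ε)
  have hn0 : (0 : ℝ) < n := lt_of_le_of_lt (by positivity) hn
  obtain ⟨z, hz⟩ := IsAlgClosed.exists_pow_nat_eq (u : K) (n := n) (by exact_mod_cast hn0)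
  have hz0 : z ≠ 0 := by
    rintro rfl
    rw [zero_pow (by rintro rfl; simp at hn0)] at hz
    exact u.ne_zero hz.symm
  set x : Kˣ := Units.mk0 z hz0 with hx
  have hxu : x ^ n = u := Units.ext (by simpa [hx] using hz)
  set η := (unitVal v x).toAdd with hη
  have hnη : n * η = c := by
    rw [hc, ← hxu, map_pow, toAdd_pow, nsmul_eq_mul]
  have hη0 : 0 < η := by
    by_contra h
    push Not at h
    nlinarith
  have hNη : N * η < ε := by
    rw [div_lt_iff₀ hε] at hn
    have : n * (N * η) < n * ε := by
      calc n * (N * η) = N * (n * η) := by ring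
        _ = N * c := by rw [hnη]
        _ < n * ε := hn
    exact lt_of_mul_lt_mul_left this hn0.le
  let idx : σ → ℤ := fun r => (Fintype.equivFin σ r : ℕ)
  have hidx0 : ∀ r, 0 ≤ idx r := fun r => by positivity
  have hidxN : ∀ r, idx r < N := fun r => by
    have := (Fintype.equivFin σ r).2
    simp only [idx, hN]
    omega
  let m : σ → ℤ := fun r => idx r + N * ⌊ω r / (N * η)⌋
  have hval : ∀ r, (unitVal v (x ^ m r)).toAdd = m r * η := fun r => by
    rw [map_zpow, toAdd_zpow, zsmul_eq_mul]
  refine ⟨fun r => x ^ m r, fun r r' h => ?_, fun r => ?_⟩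
  · simp only [hval] at h
    have hm : m r = m r' := by exact_mod_cast mul_right_cancel₀ hη0.ne' h
    have hmod := congrArg (· % (N : ℤ)) hm
    simp only [m, Int.add_mul_emod_self_left, Int.emod_eq_of_lt (hidx0 _) (hidxN _)] at hmod
    exact (Fintype.equivFin σ).injective (Fin.ext (Int.natCast_inj.1 hmod))
  · have h1 := Int.floor_le (ω r / (N * η))
    have h2 := Int.lt_floor_add_one (ω r / (N * η))
    rw [le_div_iff₀ (by positivity)] at h1
    rw [div_lt_iff₀ (by positivity)] at h2
    have h3 : (0 : ℝ) ≤ idx r := by exact_mod_cast hidx0 r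
    have h4 : (idx r : ℝ) ≤ N := by exact_mod_cast (hidxN r).le
    rw [hval, abs_lt]
    simp only [m]
    push_cast
    constructor <;> nlinarith

end

/-! ### Tropical hypersurfaces -/

section

variable {σ : Type*}

theorem mem_tropHypersurface_iff [Fintype σ] {f : TropLaurent σ} (hf : f.coeff.support.Nonempty)
    {w : σ → ℝ} :
    w ∈ tropHypersurface f ↔ ∀ e₀ ∈ f.coeff.support, ∃ e ∈ f.coeff.support, e ≠ e₀ ∧
      Tropical.untrop (tropTerm f w e) ≤ Tropical.untrop (tropTerm f w e₀) := by
  have hev : Tropical.untrop (tropEval f w) =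
      f.coeff.support.inf fun e => Tropical.untrop (tropTerm f w e) := by
    rw [tropEval, Finset.untrop_sum']
    rfl
  have hle : ∀ e ∈ f.coeff.support,
      Tropical.untrop (tropEval f w) ≤ Tropical.untrop (tropTerm f w e) := fun e he => by
    rw [hev]
    exact Finset.inf_le he
  constructor
  · rintro ⟨e₁, h₁, e₂, h₂, hne, heq₁, heq₂⟩ e₀ h₀
    by_cases h : e₁ = e₀
    · exact ⟨e₂, h₂, fun h' => hne (h.trans h'.symm), heq₂ ▸ hle e₀ h₀⟩
    · exact ⟨e₁, h₁, h, heq₁ ▸ hle e₀ h₀⟩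
  · intro h
    obtain ⟨e₀, h₀, hmin⟩ := Finset.exists_mem_eq_inf _ hf
      fun e => Tropical.untrop (tropTerm f w e)
    rw [← hev] at hmin
    obtain ⟨e, he, hne, hee⟩ := h e₀ h₀
    refine ⟨e₀, h₀, e, he, hne.symm, Tropical.untrop_injective hmin,
      Tropical.untrop_injective (le_antisymm (hle e he) ?_)⟩
    rw [hmin]
    exact hee

variable {K : Type*} [Field K] (v : AddValuation K (WithTop ℝ))

theorem coeff_tropPoly (F : Laurent K σ) (e : σ → ℤ) :
    (tropPoly v F).coeff e = Tropical.trop (v (F.coeff e)) := rfl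

theorem mem_support_tropPoly (F : Laurent K σ) (e : σ → ℤ) :
    e ∈ (tropPoly v F).coeff.support ↔ F.coeff e ≠ 0 := by
  rw [Finsupp.mem_support_iff, coeff_tropPoly, ← v.ne_top_iff, Ne, Ne, not_iff_not]
  exact ⟨fun h => congrArg Tropical.untrop h, fun h => congrArg Tropical.trop h⟩

theorem untrop_tropTerm_tropPoly [Fintype σ] (F : Laurent K σ) (w : σ → ℝ) (e : σ → ℤ) :
    Tropical.untrop (tropTerm (tropPoly v F) w e) =
      v (F.coeff e) + ((∑ k, (e k : ℝ) * w k : ℝ) : WithTop ℝ) := rfl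

theorem mem_tropHypersurface_tropPoly_iff [Fintype σ] {F : Laurent K σ} (hF : F ≠ 0)
    {w : σ → ℝ} :
    w ∈ tropHypersurface (tropPoly v F) ↔ ∀ e₀, F.coeff e₀ ≠ 0 → ∃ e, F.coeff e ≠ 0 ∧ e ≠ e₀ ∧
      v (F.coeff e) + ((∑ k, (e k : ℝ) * w k : ℝ) : WithTop ℝ) ≤
        v (F.coeff e₀) + ((∑ k, (e₀ k : ℝ) * w k : ℝ) : WithTop ℝ) := by
  have hne : (tropPoly v F).coeff.support.Nonempty := by
    obtain ⟨e, he⟩ := Finsupp.ne_iff.1 (AddMonoidAlgebra.coeff_eq_zero.not.2 hF)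
    exact ⟨e, (mem_support_tropPoly v F e).2 he⟩
  rw [mem_tropHypersurface_iff hne]
  simp only [mem_support_tropPoly, untrop_tropTerm_tropPoly]

end

/-! ### Lifting tropical points of a linear space -/

/-- Let `Λ` contain, for every combination `f` of its members and every `i` in the support of `f`,
a form supported within the support of `f` and nonzero at `i`. If `ω` attains its minimum at least
twice on the support of every linear form `c ∈ Λ`, then each coordinate `i` is nonzero at some
rational common zero of the forms in `Λ` whose support lies in `{ω ≤ ω i}`. Otherwise the
coordinate `i` would be, by duality, a combination of forms in `Λ` and of the coordinates in
`{ω > ω i}`, and a form in `Λ` supported on `i` and these coordinates, nonzero at `i`, would attain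
the minimum at `i` only. -/
theorem exists_rational_zero {ι : Type*} [Fintype ι] {Λ : Set (ι → ℤ)}
    (hΛ : ∀ f ∈ Submodule.span ℚ ((fun (c : ι → ℤ) (i : ι) => (c i : ℚ)) '' Λ), ∀ i, f i ≠ 0 →
      ∃ c ∈ Λ, c i ≠ 0 ∧ ∀ j, f j = 0 → c j = 0)
    {ω : ι → ℝ} (hω : ∀ c ∈ Λ, ∀ i, c i ≠ 0 → ∃ j, c j ≠ 0 ∧ j ≠ i ∧ ω j ≤ ω i) (i : ι) :
    ∃ y : ι → ℚ, (∀ c ∈ Λ, ∑ j, (c j : ℚ) * y j = 0) ∧ y i ≠ 0 ∧ ∀ j, y j ≠ 0 → ω j ≤ ω i := by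
  classical
  by_contra! hno
  let pair : (ι → ℤ) → Module.Dual ℚ (ι → ℚ) := fun c => ∑ j, (c j : ℚ) • LinearMap.proj j
  have hpair : ∀ c y, pair c y = ∑ j, (c j : ℚ) * y j := fun c y => by
    simp [pair, LinearMap.sum_apply]
  let fam : Λ ⊕ {j // ω i < ω j} → Module.Dual ℚ (ι → ℚ) :=
    Sum.elim (fun c => pair c) fun j => LinearMap.proj (j : ι)
  have hmem : (LinearMap.proj i : Module.Dual ℚ (ι → ℚ)) ∈ Submodule.span ℚ (Set.range fam) := by
    refine FiniteDimensional.mem_span_of_iInf_ker_le_ker fun y hy => ?_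
    rw [Submodule.mem_iInf] at hy
    by_contra hyi
    obtain ⟨j, hj0, hj⟩ := hno y (fun c hc => by
      have := hy (Sum.inl ⟨c, hc⟩)
      rw [LinearMap.mem_ker] at this
      exact (hpair c y).symm.trans this) hyi
    exact hj0 (hy (Sum.inr ⟨j, hj⟩))
  rw [Set.Sum.elim_range, Submodule.span_union, Submodule.mem_sup] at hmem
  obtain ⟨f, hf, g, hg, hfg⟩ := hmem
  have hg0 : ∀ k, ω k ≤ ω i → g (Pi.single k 1) = 0 := by
    intro k hk
    have hle : Submodule.span ℚ (Set.range fun j : {j // ω i < ω j} =>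
        (LinearMap.proj (j : ι) : Module.Dual ℚ (ι → ℚ))) ≤
        LinearMap.ker (LinearMap.applyₗ (Pi.single k (1 : ℚ) : ι → ℚ)) := by
      rw [Submodule.span_le]
      rintro _ ⟨j, rfl⟩
      have hjk : (j : ι) ≠ k := by
        rintro rfl
        exact absurd j.2 (not_lt.2 hk)
      simp [hjk]
    exact hle hg
  have hfk : ∀ k, ω k ≤ ω i → f (Pi.single k 1) = (Pi.single k 1 : ι → ℚ) i := by
    intro k hk
    have := DFunLike.congr_fun hfg (Pi.single k 1)
    rwa [LinearMap.add_apply, hg0 k hk, add_zero] at this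
  have hfspan : (fun k => f (Pi.single k 1)) ∈
      Submodule.span ℚ ((fun (c : ι → ℤ) (i : ι) => (c i : ℚ)) '' Λ) := by
    let toVec : Module.Dual ℚ (ι → ℚ) →ₗ[ℚ] (ι → ℚ) :=
      LinearMap.pi fun k => LinearMap.applyₗ (Pi.single k (1 : ℚ) : ι → ℚ)
    have hle : Submodule.span ℚ (Set.range fun c : Λ => pair c) ≤ (Submodule.span ℚ
        ((fun (c : ι → ℤ) (i : ι) => (c i : ℚ)) '' Λ)).comap toVec := by
      rw [Submodule.span_le]
      rintro _ ⟨c, rfl⟩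
      refine Submodule.subset_span ⟨c, c.2, ?_⟩
      ext k
      simp [toVec, hpair, Pi.single_apply]
    exact hle hf
  obtain ⟨c, hc, hci, hcz⟩ := hΛ _ hfspan i (by simp [hfk i le_rfl])
  obtain ⟨j, hcj, hji, hj⟩ := hω c hc i hci
  exact hcj (hcz j (by simp [hfk j hj, hji.symm]))

section

variable {K σ ι : Type*} [Field K] [Fintype ι] (b : Module.Basis σ ℤ (σ → ℤ)) {a : ι → σ}

theorem coeff_monoForm [DecidableEq ι] (ha : Function.Injective a) (c : ι → K) (i : ι) :
    (monoForm b a c).coeff (b (a i)) = c i := by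
  classical
  rw [monoForm, AddMonoidAlgebra.coeff_sum, Finsupp.finsetSum_apply, Finset.sum_eq_single i]
  · simp
  · intro j _ hj
    simp [ha.eq_iff, hj, b.injective.eq_iff]
  · exact fun h => absurd (Finset.mem_univ i) h

theorem exists_of_coeff_monoForm_ne_zero (c : ι → K) {e : σ → ℤ}
    (he : (monoForm b a c).coeff e ≠ 0) : ∃ i, e = b (a i) := by
  classical
  by_contra! h
  apply he
  rw [monoForm, AddMonoidAlgebra.coeff_sum, Finsupp.finsetSum_apply]
  exact Finset.sum_eq_zero fun i _ => by
    simp [(h i).symm]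

theorem sum_mul_eq_sum_repr_mul [Fintype σ] (e : σ → ℤ) (w : σ → ℝ) :
    ∑ k, (e k : ℝ) * w k = ∑ r, (b.repr e r : ℝ) * ∑ k, (b r k : ℝ) * w k := by
  have h : ∀ k, (e k : ℝ) = ∑ r, (b.repr e r : ℝ) * (b r k : ℝ) := by
    intro k
    have := congrFun (b.sum_repr e) k
    rw [Finset.sum_apply] at this
    exact_mod_cast this.symm
  simp only [h, Finset.sum_mul, Finset.mul_sum]
  rw [Finset.sum_comm]
  exact Finset.sum_congr rfl fun r _ => Finset.sum_congr rfl fun k _ => by ring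

theorem val_prod_zpow (v : AddValuation K (WithTop ℝ)) [Fintype σ] (s : σ → Kˣ) (n : σ → ℤ) :
    v ((∏ r, s r ^ n r : Kˣ) : K) =
      ((∑ r, (n r : ℝ) * (unitVal v (s r)).toAdd : ℝ) : WithTop ℝ) := by
  rw [← coe_unitVal, map_prod, toAdd_prod]
  simp [toAdd_zpow]

/-- The tropicalization of the common zeros of integral linear forms in monomials is cut out by
the forms themselves, as soon as these contain, for every combination `f` of them and every `i` in
the support of `f`, a form supported within the support of `f` and nonzero at `i`. A point in the intersection of
the tropical hypersurfaces of the forms is approximated by the valuations of points of the torus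
at which the forms vanish, whereas near the complement of the tropical hypersurface of `F` the
value of `F` is nonzero. -/
theorem tropIdeal_vanishingIdeal_eq [CharZero K] [IsAlgClosed K] [Fintype σ] [DecidableEq σ]
    (v : AddValuation K (WithTop ℝ)) (hv : ∃ t : K, t ≠ 0 ∧ v t ≠ 0)
    [CharZero (IsLocalRing.ResidueField v.valuationSubring)] (ha : Function.Injective a)
    {Λ : Set (ι → ℤ)} (hΛ0 : ∀ c ∈ Λ, c ≠ 0)
    (hΛ : ∀ f ∈ Submodule.span ℚ ((fun (c : ι → ℤ) (i : ι) => (c i : ℚ)) '' Λ), ∀ i, f i ≠ 0 →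
      ∃ c ∈ Λ, c i ≠ 0 ∧ ∀ j, f j = 0 → c j = 0) :
    tropIdeal v (vanishingIdeal
        {u | ∀ c ∈ Λ, evalAt u (monoForm b a fun i => (c i : K)) = 0}) =
      ⋂ c ∈ Λ, tropHypersurface (tropPoly v (monoForm b a fun i => (c i : K))) := by
  classical
  have hform0 : ∀ c ∈ Λ, monoForm b a (fun i => (c i : K)) ≠ 0 := by
    intro c hc h0
    apply hΛ0 c hc
    funext i
    have := coeff_monoForm b ha (fun i => (c i : K)) i
    rw [h0, AddMonoidAlgebra.coeff_zero, Finsupp.zero_apply] at this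
    exact_mod_cast this.symm
  refine Set.Subset.antisymm (fun w hw => Set.mem_iInter₂.2 fun c hc => hw _ ?_ (hform0 c hc)) ?_
  · exact mem_vanishingIdeal.2 fun u hu => hu c hc
  intro w hw F hF hF0
  rw [Set.mem_iInter₂] at hw
  set ω : σ → ℝ := fun r => ∑ k, (b r k : ℝ) * w k with hωdef
  have hω : ∀ c ∈ Λ, ∀ i, c i ≠ 0 → ∃ j, c j ≠ 0 ∧ j ≠ i ∧ ω (a j) ≤ ω (a i) := by
    intro c hc i hi
    obtain ⟨e, he, hne, hle⟩ := (mem_tropHypersurface_tropPoly_iff v (hform0 c hc)).1 (hw c hc)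
      (b (a i)) (by rw [coeff_monoForm b ha]; exact_mod_cast hi)
    obtain ⟨j, rfl⟩ := exists_of_coeff_monoForm_ne_zero b _ he
    rw [coeff_monoForm b ha] at he hle
    rw [coeff_monoForm b ha] at hle
    have hj : c j ≠ 0 := by exact_mod_cast he
    rw [val_intCast_eq_zero v hj, val_intCast_eq_zero v hi, zero_add, zero_add,
      WithTop.coe_le_coe] at hle
    exact ⟨j, hj, fun h => hne (by rw [h]), hle⟩
  choose y hyΛ hyi hyω using exists_rational_zero hΛ (ω := fun i => ω (a i)) hω
  by_contra hwF
  rw [mem_tropHypersurface_tropPoly_iff v hF0] at hwF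
  push Not at hwF
  obtain ⟨e₀, he₀, hmin⟩ := hwF
  have hcoe : ∀ e, F.coeff e ≠ 0 → (((v (F.coeff e)).untopD 0 : ℝ) : WithTop ℝ) = v (F.coeff e) :=
    fun e he => by
      obtain ⟨x, hx⟩ := WithTop.ne_top_iff_exists.1 (v.ne_top_iff.2 he)
      rw [← hx, WithTop.untopD_coe]
  -- That the term `e₀` of `F` is the unique minimal one is an open condition.
  have hopen : ∀ᶠ ω' in nhds ω, ∀ e ∈ F.coeff.support, e ≠ e₀ →
      (v (F.coeff e₀)).untopD 0 + ∑ r, (b.repr e₀ r : ℝ) * ω' r <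
        (v (F.coeff e)).untopD 0 + ∑ r, (b.repr e r : ℝ) * ω' r := by
    rw [Filter.eventually_all_finset]
    intro e he
    rw [Finsupp.mem_support_iff] at he
    by_cases hee : e = e₀
    · exact Filter.Eventually.of_forall fun _ h => absurd hee h
    have hlt := hmin e he hee
    rw [← hcoe e he, ← hcoe e₀ he₀, sum_mul_eq_sum_repr_mul b e₀, sum_mul_eq_sum_repr_mul b e,
      ← WithTop.coe_add, ← WithTop.coe_add, WithTop.coe_lt_coe] at hlt
    have hcont : ∀ x : σ → ℤ, Continuous fun ω' : σ → ℝ =>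
        (v (F.coeff x)).untopD 0 + ∑ r, (b.repr x r : ℝ) * ω' r := fun x => by fun_prop
    exact ((hcont e₀).continuousAt.eventually_lt (hcont e).continuousAt hlt).mono fun _ h _ => h
  obtain ⟨ε, hε, hball⟩ := Metric.eventually_nhds_iff.1 hopen
  obtain ⟨t, htinj, ht⟩ := exists_units_unitVal_near v hv ω hε
  -- The valuations `t (a i)` being distinct, no cancellation occurs in `∑ i, t (a i) * y i j`.
  have hsum : ∀ j, ∃ x : Kˣ, (x : K) = ∑ i, (t (a i) : K) * (y i j : K) ∧
      |(unitVal v x).toAdd - ω (a j)| < ε := by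
    intro j
    obtain ⟨i₀, hi₀, hmin₀⟩ := Finset.exists_min_image
      (Finset.univ.filter fun i => y i j ≠ 0) (fun i => (unitVal v (t (a i))).toAdd)
      ⟨j, by simp [hyi j]⟩
    rw [Finset.mem_filter] at hi₀
    have hyK : ∀ i, y i j ≠ 0 → v ((t (a i) : K) * (y i j : K)) =
        ((unitVal v (t (a i))).toAdd : ℝ) := fun i hi => by
      rw [v.map_mul, val_ratCast_eq_zero v hi, add_zero, coe_unitVal]
    have hval : v (∑ i, (t (a i) : K) * (y i j : K)) = ((unitVal v (t (a i₀))).toAdd : ℝ) := by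
      rw [← hyK i₀ hi₀.2]
      refine val_sum_eq v (Finset.mem_univ i₀)
        (mul_ne_zero (t (a i₀)).ne_zero (by exact_mod_cast hi₀.2)) fun i _ hi => ?_
      by_cases hyij : y i j = 0
      · rw [hyK i₀ hi₀.2, hyij, Rat.cast_zero, mul_zero, v.map_zero]
        exact WithTop.coe_lt_top _
      · rw [hyK i₀ hi₀.2, hyK i hyij, WithTop.coe_lt_coe]
        exact lt_of_le_of_ne (hmin₀ i (by simp [hyij])) fun h => hi (ha (htinj h)).symm
    have hne : ∑ i, (t (a i) : K) * (y i j : K) ≠ 0 := by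
      rw [← v.ne_top_iff, hval]
      exact WithTop.coe_ne_top
    refine ⟨Units.mk0 _ hne, rfl, ?_⟩
    have hx : (unitVal v (Units.mk0 _ hne)).toAdd = (unitVal v (t (a i₀))).toAdd := by
      rw [← WithTop.coe_inj, coe_unitVal]
      exact hval
    rw [hx, abs_lt]
    have h1 := abs_lt.1 (ht (a i₀))
    have h2 := abs_lt.1 (ht (a j))
    have h3 := hmin₀ j (by simp [hyi j])
    have h4 := hyω i₀ j hi₀.2
    constructor <;> linarith
  choose z hz hzω using hsum
  let s : σ → Kˣ := fun r => if h : ∃ i, a i = r then z h.choose else t r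
  have hsa : ∀ i, s (a i) = z i := fun i => by
    have h : ∃ j, a j = a i := ⟨i, rfl⟩
    simp only [s, dif_pos h, ha h.choose_spec]
  have hsω : ∀ r, |(unitVal v (s r)).toAdd - ω r| < ε := fun r => by
    by_cases h : ∃ i, a i = r
    · obtain ⟨i, rfl⟩ := h
      rw [hsa]
      exact hzω i
    · simp only [s, dif_neg h]
      exact ht r
  have hmemV : monoPoint b s ∈ {u | ∀ c ∈ Λ, evalAt u (monoForm b a fun i => (c i : K)) = 0} := by
    intro c hc
    rw [evalAt_monoPoint_monoForm]
    simp only [hsa, hz, Finset.mul_sum]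
    rw [Finset.sum_comm]
    refine Finset.sum_eq_zero fun i _ => ?_
    have h0 : ∑ j, (c j : K) * (y i j : K) = 0 := by
      exact_mod_cast congrArg (Rat.cast : ℚ → K) (hyΛ i c hc)
    calc ∑ j, (c j : K) * ((t (a i) : K) * (y i j : K))
        = (t (a i) : K) * ∑ j, (c j : K) * (y i j : K) := by
          rw [Finset.mul_sum]
          exact Finset.sum_congr rfl fun j _ => by ring
      _ = 0 := by rw [h0, mul_zero]
  have hFu : evalAt (monoPoint b s) F = 0 := mem_vanishingIdeal.1 hF _ hmemV
  have hFsum : evalAt (monoPoint b s) F =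
      ∑ e ∈ F.coeff.support, F.coeff e * ((∏ r, s r ^ b.repr e r : Kˣ) : K) := by
    conv_lhs => rw [← AddMonoidAlgebra.sum_coeff_single F, Finsupp.sum, map_sum]
    exact Finset.sum_congr rfl fun e _ => by rw [evalAt_single, prod_monoPoint_zpow]
  have hterm : ∀ e, F.coeff e ≠ 0 → v (F.coeff e * ((∏ r, s r ^ b.repr e r : Kˣ) : K)) =
      (((v (F.coeff e)).untopD 0 + ∑ r, (b.repr e r : ℝ) * (unitVal v (s r)).toAdd : ℝ) :
        WithTop ℝ) := fun e he => by
    rw [v.map_mul, val_prod_zpow, WithTop.coe_add, hcoe e he]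
  have hlt := hball (y := fun r => (unitVal v (s r)).toAdd) (by
    rw [dist_pi_lt_iff hε]
    exact fun r => by rw [Real.dist_eq]; exact hsω r)
  have hv0 : v (evalAt (monoPoint b s) F) ≠ ⊤ := by
    rw [hFsum, val_sum_eq v (Finsupp.mem_support_iff.2 he₀) (mul_ne_zero he₀ (Units.ne_zero _))
      fun e he hee => by
        rw [hterm e₀ he₀, hterm e (Finsupp.mem_support_iff.1 he), WithTop.coe_lt_coe]
        exact hlt e he hee, hterm e₀ he₀]
    exact WithTop.coe_ne_top
  rw [hFu, v.map_zero] at hv0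
  exact hv0 rfl

end

/-! ### Tropical bases given by the primitive facet functions -/

section

variable {K : Type*} [Field K] {d : ℕ} {A : Finset (Fin d → ℤ)}

/-- The form `∑ i, L(i) x^{b (a i)}`, `i ∈ A`, attached to an integral affine function `L`. -/
def facetForm (K : Type*) [Field K] (A : Finset (Fin d → ℤ)) {σ : Type*}
    (b : Module.Basis σ ℤ (σ → ℤ)) (a : A → σ) (L : IntAffine d) : Laurent K σ :=
  monoForm b a fun i => (L.eval (i : Fin d → ℤ) : K)

/-- The common zeros in the torus of the forms attached to the primitive facet functions. -/
def facetVariety (K : Type*) [Field K] (A : Finset (Fin d → ℤ)) {σ : Type*} [Fintype σ]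
    (b : Module.Basis σ ℤ (σ → ℤ)) (a : A → σ) : Set (σ → Kˣ) :=
  {u | ∀ L ∈ primitiveFacetFunctions A, evalAt u (facetForm K A b a L) = 0}

/-- The primitive facet functions are the elementary vectors, up to a factor, among the affine
functions on `A`. -/
theorem exists_elementary (hd : 1 ≤ d) (hA : affineDim (A : Set (Fin d → ℤ)) = d) {f : A → ℚ}
    (hf : f ∈ Submodule.span ℚ ((fun (c : A → ℤ) (i : A) => (c i : ℚ)) ''
      ((fun (L : IntAffine d) (i : A) => L.eval (i : Fin d → ℤ)) '' primitiveFacetFunctions A)))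
    (i : A) (hi : f i ≠ 0) :
    ∃ c ∈ (fun (L : IntAffine d) (i : A) => L.eval (i : Fin d → ℤ)) '' primitiveFacetFunctions A,
      c i ≠ 0 ∧ ∀ j, f j = 0 → c j = 0 := by
  let restr : ((Fin d → ℚ) × ℚ) →ₗ[ℚ] (A → ℚ) :=
    LinearMap.pi fun i : A => affEval ℚ (i : Fin d → ℤ)
  obtain ⟨p, rfl⟩ : f ∈ LinearMap.range restr := by
    refine Submodule.span_le.2 ?_ hf
    rintro _ ⟨_, ⟨L, -, rfl⟩, rfl⟩
    exact ⟨L.toField ℚ, funext fun i => affEval_toField ℚ L i⟩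
  obtain ⟨L, hL, hz, hLi⟩ := exists_mem_primitiveFacetFunctions hd hA
    (S := {j | j ∈ A ∧ affEval ℚ j p = 0}) (fun j hj => hj.1) p (fun j hj => hj.2) hi
  exact ⟨_, ⟨L, hL, rfl⟩, hLi, fun j hj => hz j ⟨j.2, hj⟩⟩

theorem isTropicalBasis_facetForm [CharZero K] [IsAlgClosed K] (v : AddValuation K (WithTop ℝ))
    (hv : ∃ t : K, t ≠ 0 ∧ v t ≠ 0)
    [CharZero (IsLocalRing.ResidueField v.valuationSubring)] (hd : 1 ≤ d)
    (hA : affineDim (A : Set (Fin d → ℤ)) = d) {σ : Type*} [Fintype σ] [DecidableEq σ]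
    (b : Module.Basis σ ℤ (σ → ℤ)) {a : A → σ} (ha : Function.Injective a) :
    IsTropicalBasis v (facetForm K A b a '' primitiveFacetFunctions A)
      (vanishingIdeal (facetVariety K A b a)) := by
  refine ⟨(finite_primitiveFacetFunctions hd hA).image _, ?_, ?_⟩
  · have := span_monoForm_eq_vanishingIdeal b a ha ((fun (L : IntAffine d) (i : A) =>
      (L.eval (i : Fin d → ℤ) : K)) '' primitiveFacetFunctions A)
    simp only [Set.forall_mem_image, Set.image_image] at this
    exact this
  · have := tropIdeal_vanishingIdeal_eq b v hv ha (Λ := (fun (L : IntAffine d) (i : A) =>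
      L.eval (i : Fin d → ℤ)) '' primitiveFacetFunctions A) ?_
      fun f hf i hi => exists_elementary hd hA hf i hi
    · simp only [Set.forall_mem_image, Set.biInter_image] at this
      rw [Set.biInter_image]
      exact this
    · rintro _ ⟨L, hL, rfl⟩ h0
      obtain ⟨i, hi, hLi⟩ := exists_eval_ne_zero_of_mem_facetFunctions hA hL.1
      exact hLi (congrFun h0 ⟨i, hi⟩)

theorem facetForm_eq_smul {σ : Type*} (b : Module.Basis σ ℤ (σ → ℤ)) (a : A → σ)
    {L M : IntAffine d} {g : ℤ} (h : ∀ i, L.eval i = g * M.eval i) :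
    facetForm K A b a L = (g : K) • facetForm K A b a M := by
  simp [facetForm, monoForm, h, Finset.smul_sum, AddMonoidAlgebra.smul_single]

theorem tropPoly_smul {σ : Type*} (v : AddValuation K (WithTop ℝ)) {c : K} (hc : v c = 0)
    (F : Laurent K σ) : tropPoly v (c • F) = tropPoly v F := by
  apply AddMonoidAlgebra.coeff_injective
  ext e
  rw [coeff_tropPoly, coeff_tropPoly, AddMonoidAlgebra.coeff_smul_apply, smul_eq_mul, v.map_mul,
    hc, zero_add]

theorem image_tropPoly_facetForm (v : AddValuation K (WithTop ℝ))
    [CharZero (IsLocalRing.ResidueField v.valuationSubring)] (hd : 1 ≤ d)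
    (hA : affineDim (A : Set (Fin d → ℤ)) = d) {σ : Type*} (b : Module.Basis σ ℤ (σ → ℤ))
    (a : A → σ) :
    tropPoly v ∘ facetForm K A b a '' primitiveFacetFunctions A =
      tropPoly v ∘ facetForm K A b a '' facetFunctions A := by
  refine Set.Subset.antisymm (Set.image_mono fun L hL => hL.1) ?_
  rintro _ ⟨L, hL, rfl⟩
  obtain ⟨M, hM, g, hg, h⟩ := exists_primitive hd hA hL
  refine ⟨M, hM, ?_⟩
  rw [Function.comp_apply, Function.comp_apply, facetForm_eq_smul b a h,
    tropPoly_smul v (val_intCast_eq_zero v hg)]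

theorem span_facetForm_image (hd : 1 ≤ d) (hA : affineDim (A : Set (Fin d → ℤ)) = d)
    {σ : Type*} (b : Module.Basis σ ℤ (σ → ℤ)) (a : A → σ) :
    Ideal.span (facetForm K A b a '' facetFunctions A) =
      Ideal.span (facetForm K A b a '' primitiveFacetFunctions A) := by
  refine le_antisymm (Ideal.span_le.2 ?_) (Ideal.span_mono (Set.image_mono fun L hL => hL.1))
  rintro _ ⟨L, hL, rfl⟩
  obtain ⟨M, hM, g, hg, h⟩ := exists_primitive hd hA hL
  rw [facetForm_eq_smul b a h, Algebra.smul_def]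
  exact Ideal.mul_mem_left _ _ (Ideal.subset_span ⟨M, hM, rfl⟩)

/-! ### Singular points and Euler derivatives -/

theorem partialDeriv_sum_single {σ ι : Type*} [DecidableEq σ] (k : σ) (s : Finset ι)
    (e : ι → σ → ℤ) (c : ι → K) :
    partialDeriv k (∑ i ∈ s, AddMonoidAlgebra.single (e i) (c i)) =
      ∑ i ∈ s, AddMonoidAlgebra.single (e i - Pi.single k 1) ((e i k : K) * c i) := by
  rw [partialDeriv, AddMonoidAlgebra.coeff_sum, ← Finsupp.sum_finsetSum_index]
  · exact Finset.sum_congr rfl fun i _ => by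
      rw [AddMonoidAlgebra.coeff_single, Finsupp.sum_single_index (by simp)]
  · simp
  · intro x y z
    rw [mul_add, AddMonoidAlgebra.single_add]

/-- A polynomial with support `A` is singular at `u` if and only if the values of its terms at `u`
satisfy the linear relations given by the primitive facet functions. -/
theorem isSingularAt_iff [CharZero K] (hd : 1 ≤ d) (hA : affineDim (A : Set (Fin d → ℤ)) = d)
    (c : A → Kˣ) (u : Fin d → Kˣ) :
    IsSingularAt (polyOf A c) u ↔ ∀ L ∈ primitiveFacetFunctions A,
      ∑ i : A, (L.eval (i : Fin d → ℤ) : K) *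
        ((c i * ∏ k, u k ^ (i : Fin d → ℤ) k : Kˣ) : K) = 0 := by
  obtain ⟨y, hy⟩ : ∃ y : A → K, ∀ i : A,
      ((c i * ∏ k, u k ^ (i : Fin d → ℤ) k : Kˣ) : K) = y i := ⟨_, fun _ => rfl⟩
  simp only [hy]
  have h0 : evalAt u (polyOf A c) = ∑ i, y i := by
    rw [polyOf, map_sum]
    exact Finset.sum_congr rfl fun i _ => by rw [evalAt_single, ← hy, Units.val_mul]
  have h1 : ∀ k, evalAt u (partialDeriv k (polyOf A c)) =
      (∑ i : A, ((i : Fin d → ℤ) k : K) * y i) * ((u k)⁻¹ : Kˣ) := by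
    intro k
    rw [polyOf, partialDeriv_sum_single, map_sum, Finset.sum_mul]
    refine Finset.sum_congr rfl fun i _ => ?_
    have : ∏ l, u l ^ ((i : Fin d → ℤ) - Pi.single k 1 : Fin d → ℤ) l =
        (∏ l, u l ^ (i : Fin d → ℤ) l) * (u k)⁻¹ := by
      simp only [Pi.sub_apply, zpow_sub, Finset.prod_mul_distrib]
      congr 1
      rw [Finset.prod_inv_distrib, Finset.prod_eq_single k]
      · simp
      · intro l _ hl
        simp [hl]
      · exact fun h => absurd (Finset.mem_univ k) h
    rw [evalAt_single, this, ← hy]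
    push_cast
    ring
  have h1' : ∀ k, evalAt u (partialDeriv k (polyOf A c)) = 0 ↔
      ∑ i : A, ((i : Fin d → ℤ) k : K) * y i = 0 := by
    intro k
    rw [h1, mul_eq_zero, or_iff_left (Units.ne_zero _)]
  rw [IsSingularAt, h0]
  simp only [h1']
  constructor
  · rintro ⟨hs, hk⟩ L -
    have : ∀ i : A, (L.eval (i : Fin d → ℤ) : K) * y i =
        ∑ k, (L.lin k : K) * (((i : Fin d → ℤ) k : K) * y i) + L.const * y i := by
      intro i
      simp only [IntAffine.eval, Int.cast_add, Int.cast_sum, Int.cast_mul, add_mul,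
        Finset.sum_mul, mul_assoc]
    rw [Finset.sum_congr rfl fun i _ => this i, Finset.sum_add_distrib, ← Finset.mul_sum, hs,
      mul_zero, add_zero, Finset.sum_comm]
    exact Finset.sum_eq_zero fun k _ => by rw [← Finset.mul_sum, hk, mul_zero]
  · intro h
    refine ⟨?_, fun k => ?_⟩
    · simpa [affEval_apply] using sum_affEval_mul_eq_zero hd hA h (0, 1)
    · simpa [affEval_apply, Pi.single_apply] using
        sum_affEval_mul_eq_zero hd hA h (Pi.single k 1, 0)

theorem eulerForm_eq_facetForm (L : IntAffine d) :
    eulerForm K A L = facetForm K A (Pi.basisFun ℤ A) id L := by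
  simp [eulerForm, facetForm, monoForm, varX, AddMonoidAlgebra.smul_single]

theorem singularAtOne_eq_facetVariety [CharZero K] (hd : 1 ≤ d)
    (hA : affineDim (A : Set (Fin d → ℤ)) = d) :
    singularAtOne K A = facetVariety K A (Pi.basisFun ℤ A) id := by
  ext c
  rw [singularAtOne, Set.mem_ofPred_eq, isSingularAt_iff hd hA]
  refine forall₂_congr fun L _ => ?_
  have : ∀ i : A, ∏ k, c k ^ (Pi.basisFun ℤ A) i k = c i := by
    intro i
    rw [Finset.prod_eq_single i]
    · simp
    · intro l _ hl
      simp [hl]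
    · exact fun h => absurd (Finset.mem_univ i) h
  have h1 : ∀ i : A, c i * ∏ k, (1 : Fin d → Kˣ) k ^ (i : Fin d → ℤ) k = c i := by simp
  have h1' : ∀ i : A, c i * ∏ k : Fin d, (1 : Kˣ) ^ (i : Fin d → ℤ) k = c i := h1
  simp only [facetForm, evalAt_monoForm, id, this, h1']

theorem tropPoly_eulerForm (v : AddValuation K (WithTop ℝ))
    [CharZero (IsLocalRing.ResidueField v.valuationSubring)] (L : IntAffine d) :
    tropPoly v (eulerForm K A L) = tropForm A L := by
  apply AddMonoidAlgebra.coeff_injective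
  ext e
  rw [coeff_tropPoly, eulerForm_eq_facetForm, facetForm, tropForm, AddMonoidAlgebra.coeff_sum,
    Finsupp.finsetSum_apply]
  by_cases he : ∃ i, e = Pi.single i 1
  · obtain ⟨i, rfl⟩ := he
    have hb : (Pi.single i 1 : A → ℤ) = Pi.basisFun ℤ A (id i) := by simp
    have hc : ∀ j : A, (AddMonoidAlgebra.single (Pi.single j (1 : ℤ) : A → ℤ)
        (Tropical.trop ((0 : ℝ) : WithTop ℝ))).coeff (Pi.single i 1) =
        if j = i then Tropical.trop ((0 : ℝ) : WithTop ℝ) else 0 := by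
      intro j
      classical
      rw [AddMonoidAlgebra.coeff_single, Finsupp.single_apply]
      refine if_congr ⟨fun h => ?_, fun h => by rw [h]⟩ rfl rfl
      by_contra hne
      have := congrFun h j
      simp [hne] at this
    simp only [hc, Finset.sum_ite_eq', Finset.mem_filter, Finset.mem_univ, true_and]
    rw [hb, coeff_monoForm _ Function.injective_id]
    by_cases h0 : L.eval i = 0
    · rw [h0, Int.cast_zero, v.map_zero, if_neg (by simp)]
      rfl
    · rw [val_intCast_eq_zero v h0, if_pos h0]
      rfl
  · rw [Finset.sum_eq_zero]
    · have : (monoForm (Pi.basisFun ℤ A) id fun i : A => (L.eval (i : Fin d → ℤ) : K)).coeff e =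
          0 := by
        by_contra h
        obtain ⟨i, hi⟩ := exists_of_coeff_monoForm_ne_zero _ _ h
        exact he ⟨i, by simpa using hi⟩
      rw [this, v.map_zero]
      rfl
    · intro i _
      classical
      rw [AddMonoidAlgebra.coeff_single, Finsupp.single_apply,
        if_neg fun h => he ⟨i, h.symm⟩]

/-- The shear of the lattice of exponents in the variables `y_i`, `x_k` that sends the exponent of
`y_i` to that of `y_i x^i` and fixes those of the `x_k`. -/
def shear (A : Finset (Fin d → ℤ)) : (A ⊕ Fin d → ℤ) ≃ₗ[ℤ] (A ⊕ Fin d → ℤ) where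
  toFun f := Sum.elim (fun i => f (Sum.inl i))
    fun k => f (Sum.inr k) + ∑ i : A, f (Sum.inl i) * (i : Fin d → ℤ) k
  invFun f := Sum.elim (fun i => f (Sum.inl i))
    fun k => f (Sum.inr k) - ∑ i : A, f (Sum.inl i) * (i : Fin d → ℤ) k
  map_add' f g := by
    ext (i | k)
    · simp
    · simp [add_mul, Finset.sum_add_distrib]
      ring
  map_smul' r f := by
    ext (i | k)
    · simp
    · simp [mul_add, Finset.mul_sum, mul_assoc]
  left_inv f := by ext (i | k) <;> simp
  right_inv f := by ext (i | k) <;> simp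

/-- The basis of the lattice of exponents formed by those of the monomials `y_i x^i` and `x_k`. -/
def shearBasis (A : Finset (Fin d → ℤ)) : Module.Basis (A ⊕ Fin d) ℤ (A ⊕ Fin d → ℤ) :=
  (Pi.basisFun ℤ (A ⊕ Fin d)).map (shear A)

theorem shearBasis_inl (i : A) :
    shearBasis A (Sum.inl i) = Sum.elim (Pi.single i (1 : ℤ)) (i : Fin d → ℤ) := by
  ext (j | k)
  · simp [shearBasis, shear, Pi.single_apply]
  · simp [shearBasis, shear, Pi.single_apply]

theorem genericEuler_eq_facetForm (L : IntAffine d) :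
    genericEuler K A L = facetForm K A (shearBasis A) Sum.inl L := by
  have h : ∀ k : Fin d, varX K (Sum.inr k) * partialDeriv (Sum.inr k) (genericPoly K A) =
      ∑ i : A, AddMonoidAlgebra.single (shearBasis A (Sum.inl i)) ((i : Fin d → ℤ) k : K) := by
    intro k
    rw [genericPoly, partialDeriv_sum_single, Finset.mul_sum]
    refine Finset.sum_congr rfl fun i _ => ?_
    rw [varX, AddMonoidAlgebra.single_mul_single, shearBasis_inl]
    simp
  rw [genericEuler, facetForm, monoForm]
  simp only [h]
  simp only [genericPoly, ← shearBasis_inl, Finset.smul_sum, AddMonoidAlgebra.smul_single]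
  rw [Finset.sum_comm, ← Finset.sum_add_distrib]
  refine Finset.sum_congr rfl fun i _ => ?_
  apply AddMonoidAlgebra.coeff_injective
  simp only [AddMonoidAlgebra.coeff_add, AddMonoidAlgebra.coeff_sum,
    AddMonoidAlgebra.coeff_single, smul_eq_mul, mul_one]
  rw [← Finsupp.single_finsetSum, ← Finsupp.single_add]
  congr 1
  simp [IntAffine.eval]

theorem incidence_eq_facetVariety [CharZero K] (hd : 1 ≤ d)
    (hA : affineDim (A : Set (Fin d → ℤ)) = d) :
    incidence K A = facetVariety K A (shearBasis A) Sum.inl := by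
  ext z
  rw [incidence, Set.mem_ofPred_eq, isSingularAt_iff hd hA]
  refine forall₂_congr fun L _ => ?_
  have : ∀ i : A, ∏ t, z t ^ shearBasis A (Sum.inl i) t =
      z (Sum.inl i) * ∏ k, z (Sum.inr k) ^ (i : Fin d → ℤ) k := by
    intro i
    rw [shearBasis_inl, Fintype.prod_sum_type]
    simp only [Sum.elim_inl, Sum.elim_inr]
    congr 1
    rw [Finset.prod_eq_single i]
    · simp
    · intro l _ hl
      simp [hl]
    · exact fun h => absurd (Finset.mem_univ i) h
  simp only [facetForm, evalAt_monoForm, this]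

end

end TropEuler

end

theorem mainTheorem2 {K : Type*} [Field K] [IsAlgClosed K] [CharZero K]
    (v : AddValuation K (WithTop ℝ)) (hv : ∃ t : K, t ≠ 0 ∧ v t ≠ 0)
    [CharZero (IsLocalRing.ResidueField v.valuationSubring)]
    {d : ℕ} (hd : 1 ≤ d) (A : Finset (Fin d → ℤ))
    (hA : TropEuler.affineDim (A : Set (Fin d → ℤ)) = d) :
    -- the incidence variety
    ((TropEuler.tropPoly v ∘ TropEuler.genericEuler K A '' TropEuler.facetFunctions A).Finite ∧
      Ideal.span (TropEuler.genericEuler K A '' TropEuler.facetFunctions A) =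
        TropEuler.vanishingIdeal (TropEuler.incidence K A) ∧
      TropEuler.tropIdeal v (TropEuler.vanishingIdeal (TropEuler.incidence K A)) =
        ⋂ f ∈ TropEuler.tropPoly v ∘ TropEuler.genericEuler K A '' TropEuler.facetFunctions A,
          TropEuler.tropHypersurface f) ∧
    (TropEuler.tropPoly v ∘ TropEuler.genericEuler K A '' TropEuler.primitiveFacetFunctions A =
        TropEuler.tropPoly v ∘ TropEuler.genericEuler K A '' TropEuler.facetFunctions A ∧
      TropEuler.IsTropicalBasis v
        (TropEuler.genericEuler K A '' TropEuler.primitiveFacetFunctions A)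
        (TropEuler.vanishingIdeal (TropEuler.incidence K A))) ∧
    -- the polynomials singular at the point with all coordinates one
    ((TropEuler.tropForm A '' TropEuler.primitiveFacetFunctions A).Finite ∧
      TropEuler.tropPoly v ∘ TropEuler.eulerForm K A '' TropEuler.primitiveFacetFunctions A =
        TropEuler.tropForm A '' TropEuler.primitiveFacetFunctions A ∧
      TropEuler.IsTropicalBasis v
        (TropEuler.eulerForm K A '' TropEuler.primitiveFacetFunctions A)
        (TropEuler.vanishingIdeal (TropEuler.singularAtOne K A)) ∧
      TropEuler.tropIdeal v (TropEuler.vanishingIdeal (TropEuler.singularAtOne K A)) =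
        ⋂ f ∈ TropEuler.tropForm A '' TropEuler.primitiveFacetFunctions A,
          TropEuler.tropHypersurface f) := by
  have hfun := funext (TropEuler.genericEuler_eq_facetForm (K := K) (A := A))
  have hfun₁ := funext (TropEuler.eulerForm_eq_facetForm (K := K) (A := A))
  have himg := TropEuler.image_tropPoly_facetForm (K := K) v hd hA (TropEuler.shearBasis A) Sum.inl
  have hspan := TropEuler.span_facetForm_image (K := K) hd hA (TropEuler.shearBasis A) Sum.inl
  have hbasis := TropEuler.isTropicalBasis_facetForm v hv hd hA (TropEuler.shearBasis A)
    (a := Sum.inl) Sum.inl_injective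
  have hbasis₁ := TropEuler.isTropicalBasis_facetForm v hv hd hA (Pi.basisFun ℤ A)
    (a := id) Function.injective_id
  rw [← hfun] at himg hspan
  rw [← hfun, ← TropEuler.incidence_eq_facetVariety hd hA] at hbasis
  rw [← hfun₁, ← TropEuler.singularAtOne_eq_facetVariety hd hA] at hbasis₁
  have hform : TropEuler.tropPoly v ∘ TropEuler.eulerForm K A = TropEuler.tropForm A :=
    funext fun L => TropEuler.tropPoly_eulerForm v L
  have hfin := TropEuler.finite_primitiveFacetFunctions hd hA
  refine ⟨⟨?_, hspan.trans hbasis.2.1, ?_⟩, ⟨himg, hbasis⟩, hfin.image _, ?_, hbasis₁, ?_⟩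
  · rw [← himg]
    exact hfin.image _
  · rw [← himg, hbasis.2.2, Set.biInter_image, Set.biInter_image]
    rfl
  · rw [hform]
  · rw [← hform, hbasis₁.2.2, Set.biInter_image, Set.biInter_image]
    rfl
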